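/- Let $1\le d\le N$ be integers, $\zeta=d/N$, let $\boldsymbol\Sigma$ be a positive definite $d\times d$ matrix, $\boldsymbol\theta_0\in\mathbb R^d$ and $\sigma_0>0$. Let $\mathbf z_1,\dots,\mathbf z_N$ be independent $\mathcal N(\mathbf 0,\boldsymbol\Sigma)$ random vectors in $\mathbb R^d$, let $\boldsymbol\epsilon\sim\mathcal N(\mathbf 0,\sigma_0^2\mathbf I_N)$ be independent of them, let $\mathbf X$ be the $N\times d$ matrix with rows $\mathbf z_i^{\mathrm T}/\sqrt d$, and let $\mathbf t=\mathbf X\boldsymbol\theta_0+\boldsymbol\epsilon$. Then the maximum likelihood estimator $\hat{\boldsymbol\theta}_{\mathrm{ML}}=(\mathbf X^{\mathrm T}\mathbf X)^{-1}\mathbf X^{\mathrm T}\mathbf t$ (regularization $\eta=0$) is almost surely the unique maximizer over $\boldsymbol\theta\in\mathbb R^d$ of the likelihood $\prod_{i=1}^N\mathcal N(t_i\mid(\mathbf X\boldsymbol\theta)_i,\sigma^2)$, for every $\sigma^2>0$. Its law is exactly the $d$-dimensional Student $t$-distribution with $N+1-d$ degrees of freedom, location $\boldsymbol\theta_0$ and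 shape matrix $\frac{\zeta\sigma_0^2}{1-\zeta+1/N}\boldsymbol\Sigma^{-1}$, that is, it has the Lebesgue density $$P(\boldsymbol\theta)=[\pi(N+1-d)]^{-\frac d2}\,\frac{\Gamma\left(\frac{N+1}{2}\right)}{\Gamma\left(\frac{N+1-d}{2}\right)}\left|\frac{(1-\zeta+1/N)\boldsymbol\Sigma}{\zeta\sigma_0^2}\right|^{\frac12}\left(1+(\boldsymbol\theta-\boldsymbol\theta_0)^{\mathrm T}\frac{(1-\zeta+1/N)\boldsymbol\Sigma}{\zeta\sigma_0^2(N+1-d)}(\boldsymbol\theta-\boldsymbol\theta_0)\right)^{-\frac{N+1}{2}}.$$ The vector $\boldsymbol\theta_0$ is the unique mode of this density. If moreover $N>d+1$, then $\hat{\boldsymbol\theta}_{\mathrm{ML}}$ is square integrable and its covariance matrix is $\frac{\zeta\sigma_0^2}{1-\zeta-1/N}\boldsymbol\Sigma^{-1}$. -/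

import Mathlib

open MeasureTheory ProbabilityTheory
open scoped NNReal Matrix

noncomputable section

namespace GaussianRegression

/-- The rescaled `N × d` design matrix, whose `i`-th row is the input `z i` divided by `√d`. -/
def design {N d : ℕ} (z : Fin N → EuclideanSpace ℝ (Fin d)) : Matrix (Fin N) (Fin d) ℝ :=
  Matrix.of fun i k => z i k / √(d : ℝ)

/-- The outputs `t = X θ + ε` of the linear regression model. -/
def response {N d : ℕ} (X : Matrix (Fin N) (Fin d) ℝ) (θ : EuclideanSpace ℝ (Fin d))
    (ε : EuclideanSpace ℝ (Fin N)) : EuclideanSpace ℝ (Fin N) :=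
  WithLp.toLp 2 (X *ᵥ θ.ofLp) + ε

/-- The likelihood of the parameter `θ` for noise variance `s`, given the data `(X, t)`:
the product over `i` of the `N((X θ) i, s)` densities at `t i`. -/
def likelihood {N d : ℕ} (s : ℝ≥0) (X : Matrix (Fin N) (Fin d) ℝ) (t : EuclideanSpace ℝ (Fin N))
    (θ : EuclideanSpace ℝ (Fin d)) : ℝ :=
  ∏ i, gaussianPDFReal ((X *ᵥ θ.ofLp) i) s (t i)

/-- The maximum likelihood estimator `(Xᵀ X)⁻¹ Xᵀ t`: the ridge (MAP) estimator with
regularization `η = 0`. -/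
def mlEstimator {N d : ℕ} (X : Matrix (Fin N) (Fin d) ℝ) (t : EuclideanSpace ℝ (Fin N)) :
    EuclideanSpace ℝ (Fin d) :=
  WithLp.toLp 2 ((Xᵀ * X)⁻¹ *ᵥ (Xᵀ *ᵥ t.ofLp))

/-- The density of the `d`-dimensional Student t-distribution with `ν` degrees of freedom,
location `m` and (positive definite) shape matrix `A`. -/
def studentTPDF {d : ℕ} (ν : ℝ) (m : EuclideanSpace ℝ (Fin d)) (A : Matrix (Fin d) (Fin d) ℝ)
    (x : EuclideanSpace ℝ (Fin d)) : ℝ :=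
  Real.Gamma ((ν + d) / 2) / (Real.Gamma (ν / 2) * (ν * Real.pi) ^ ((d : ℝ) / 2) * √A.det) *
    (1 + ((x - m).ofLp ⬝ᵥ (A⁻¹ *ᵥ (x - m).ofLp)) / ν) ^ (-((ν + d) / 2))

/-- The `d`-dimensional Student t-distribution. -/
def studentT {d : ℕ} (ν : ℝ) (m : EuclideanSpace ℝ (Fin d)) (A : Matrix (Fin d) (Fin d) ℝ) :
    Measure (EuclideanSpace ℝ (Fin d)) :=
  volume.withDensity fun x => ENNReal.ofReal (studentTPDF ν m A x)

end GaussianRegression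

end

namespace GaussianRegression

/-! Whitening reduces everything to standard Gaussian data. If `S = R Rᵀ`, `z i = R g i` and `ε = σ₀
e`, the design is `G Q` with `G` the matrix of rows `g i` and `Q = Rᵀ / √d`, and almost surely the
estimator equals `θ₀ + σ₀ Q⁻¹ Y`, where `Y = (GᵀG)⁻¹Gᵀe` (`exists_standardized_estimator`).

Given `G`, `Y` is centred Gaussian with covariance `(GᵀG)⁻¹`, so its density at `x` is proportional
to `√det(GᵀG) exp(-‖Gx‖²/2)`. Averaging over `G` needs no Wishart law: the exponential merges with
the Gaussian weight of each row into `exp(-‖T g i‖²/2)`, where `TᵀT = 1 + x xᵀ`. Substituting `T g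
i` for `g i` costs `(det T)⁻ᴺ` from the Jacobian and `(det T)⁻¹` from the Gram determinant, and `det
T = √(1 + ‖x‖²)`; hence a constant times `(1 + ‖x‖²)^(-(N+1)/2)`
(`lintegral_sqrt_det_gram_mul_exp`). Total mass one fixes the constant.

An affine map then gives the Student law. The covariance follows from that of `Y`, computed by
symmetry and the radial integral of `‖x‖²`. Optimality of the estimator is Pythagoras for the
residual. -/

/-! ### Gaussian densities and linear changes of variables. -/

theorem pi_withDensity_ofReal {ι : Type*} [Fintype ι] {E : ι → Type*}
    [∀ i, MeasureSpace (E i)] [∀ i, SigmaFinite (volume : Measure (E i))]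
    {f : ∀ i, E i → ℝ} (hf : ∀ i, Integrable (f i)) (hf0 : ∀ i x, 0 ≤ f i x) :
    Measure.pi (fun i => (volume : Measure (E i)).withDensity fun x => ENNReal.ofReal (f i x)) =
      (volume : Measure (∀ i, E i)).withDensity fun x => ENNReal.ofReal (∏ i, f i (x i)) := by
  have : ∀ i, SigmaFinite ((volume : Measure (E i)).withDensity
      fun x => ENNReal.ofReal (f i x)) := fun i => SigmaFinite.withDensity_ofReal _
  refine Measure.pi_eq (μ := fun i => (volume : Measure (E i)).withDensity
    fun x => ENNReal.ofReal (f i x)) fun s hs => ?_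
  have hind : ∀ i, Integrable ((s i).indicator (f i)) := fun i => (hf i).indicator (hs i)
  have hind0 : ∀ i x, 0 ≤ (s i).indicator (f i) x :=
    fun i x => Set.indicator_nonneg (fun y _ => hf0 i y) x
  -- Each factor becomes a Bochner integral because Fubini for finite products is applied in that
  -- form (`integral_fintype_prod_eq_prod`).
  have key : ∀ i, ((volume : Measure (E i)).withDensity fun x => ENNReal.ofReal (f i x)) (s i) =
      ENNReal.ofReal (∫ x, (s i).indicator (f i) x) := by
    intro i
    rw [withDensity_apply _ (hs i), integral_indicator (hs i),
      ofReal_integral_eq_lintegral_ofReal (hf i).integrableOn (ae_of_all _ (hf0 i))]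
  simp_rw [key]
  rw [← ENNReal.ofReal_prod_of_nonneg (fun i _ => integral_nonneg (hind0 i)),
    withDensity_apply _ (MeasurableSet.univ_pi hs),
    ← integral_fintype_prod_eq_prod (fun i => (s i).indicator (f i)),
    ofReal_integral_eq_lintegral_ofReal (Integrable.fintype_prod_dep hind)
      (ae_of_all _ fun x => Finset.prod_nonneg fun i _ => hind0 i _),
    ← volume_pi, ← lintegral_indicator (MeasurableSet.univ_pi hs)]
  congr 1
  ext x
  by_cases hx : x ∈ Set.univ.pi s
  · rw [Set.indicator_of_mem hx]
    congr 1
    exact Finset.prod_congr rfl fun i _ => (Set.indicator_of_mem (hx i trivial) _).symm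
  · rw [Set.indicator_of_notMem hx]
    obtain ⟨i, hi⟩ : ∃ i, x i ∉ s i := by simpa [Set.mem_pi] using hx
    rw [Finset.prod_eq_zero (Finset.mem_univ i) (Set.indicator_of_notMem hi _)]
    simp

/-- The standard Gaussian density on a Euclidean space of dimension `d`. -/
noncomputable def stdGaussianPDF {d : ℕ} (x : EuclideanSpace ℝ (Fin d)) : ℝ :=
  (√(2 * Real.pi))⁻¹ ^ d * Real.exp (-(‖x‖ ^ 2 / 2))

theorem stdGaussianPDF_nonneg {d : ℕ} (x : EuclideanSpace ℝ (Fin d)) : 0 ≤ stdGaussianPDF x := by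
  unfold stdGaussianPDF; positivity

@[fun_prop]
theorem measurable_stdGaussianPDF {d : ℕ} :
    Measurable (stdGaussianPDF : EuclideanSpace ℝ (Fin d) → ℝ) := by
  unfold stdGaussianPDF; fun_prop

theorem stdGaussian_eq_withDensity (d : ℕ) :
    stdGaussian (EuclideanSpace ℝ (Fin d)) =
      volume.withDensity fun x => ENNReal.ofReal (stdGaussianPDF x) := by
  have h1 : Measure.pi (fun _ : Fin d => gaussianReal 0 1) =
      (volume : Measure (Fin d → ℝ)).withDensity fun x =>
        ENNReal.ofReal (∏ i, gaussianPDFReal 0 1 (x i)) := by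
    rw [← pi_withDensity_ofReal (fun _ => integrable_gaussianPDFReal 0 1)
      (fun _ x => gaussianPDFReal_nonneg 0 1 x)]
    congr 1
    ext1 i
    rw [gaussianReal_of_var_ne_zero _ one_ne_zero]
    rfl
  rw [← map_pi_eq_stdGaussian, h1]
  have hmp := PiLp.volume_preserving_toLp (Fin d)
  ext s hs
  rw [Measure.map_apply hmp.measurable hs, withDensity_apply _ (hmp.measurable hs),
    withDensity_apply _ hs, ← hmp.setLIntegral_comp_preimage hs (by fun_prop)]
  congr 1
  ext x
  congr 1
  simp only [gaussianPDFReal, stdGaussianPDF, Finset.prod_mul_distrib, Finset.prod_const,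
    ← Real.exp_sum, EuclideanSpace.real_norm_sq_eq]
  simp [Finset.sum_div, neg_div]

theorem integrable_stdGaussianPDF (d : ℕ) :
    Integrable (stdGaussianPDF : EuclideanSpace ℝ (Fin d) → ℝ) := by
  refine ⟨by fun_prop, ?_⟩
  rw [hasFiniteIntegral_iff_ofReal (ae_of_all _ stdGaussianPDF_nonneg)]
  have := measure_univ (μ := stdGaussian (EuclideanSpace ℝ (Fin d)))
  rw [stdGaussian_eq_withDensity, withDensity_apply _ MeasurableSet.univ,
    Measure.restrict_univ] at this
  rw [this]; exact ENNReal.one_lt_top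

theorem pi_stdGaussian_eq_withDensity (N d : ℕ) :
    Measure.pi (fun _ : Fin N => stdGaussian (EuclideanSpace ℝ (Fin d))) =
      volume.withDensity fun g => ENNReal.ofReal (∏ i, stdGaussianPDF (g i)) := by
  simp_rw [stdGaussian_eq_withDensity]
  exact pi_withDensity_ofReal (fun _ => integrable_stdGaussianPDF d)
    fun _ => stdGaussianPDF_nonneg

theorem lintegral_comp_linearMap {E : Type*} [NormedAddCommGroup E] [NormedSpace ℝ E]
    [MeasurableSpace E] [BorelSpace E] [FiniteDimensional ℝ E] (μ : Measure E)
    [μ.IsAddHaarMeasure] {f : E →ₗ[ℝ] E} (hf : LinearMap.det f ≠ 0) {F : E → ENNReal}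
    (hF : Measurable F) :
    ∫⁻ x, F (f x) ∂μ = ENNReal.ofReal |(LinearMap.det f)⁻¹| * ∫⁻ x, F x ∂μ := by
  have hm : Measurable f := f.continuous_of_finiteDimensional.measurable
  rw [← lintegral_map hF hm, Measure.map_linearMap_addHaar_eq_smul_addHaar μ hf,
    lintegral_smul_measure, smul_eq_mul]

/-- The Jacobian sits on the source side, so the target density is prescribed freely and no inverse
map appears. -/
theorem map_linearMap_withDensity {E : Type*} [NormedAddCommGroup E] [NormedSpace ℝ E]
    [MeasurableSpace E] [BorelSpace E] [FiniteDimensional ℝ E] (μ : Measure E)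
    [μ.IsAddHaarMeasure] {f : E →ₗ[ℝ] E} (hf : LinearMap.det f ≠ 0) {F : E → ENNReal}
    (hF : Measurable F) :
    (μ.withDensity fun x => ENNReal.ofReal |LinearMap.det f| * F (f x)).map f =
      μ.withDensity F := by
  have hm : Measurable f := f.continuous_of_finiteDimensional.measurable
  ext s hs
  rw [Measure.map_apply hm hs, withDensity_apply _ (hm hs), withDensity_apply _ hs,
    lintegral_const_mul (f := fun x => F (f x)) _ (hF.comp hm),
    ← lintegral_indicator (hm hs), ← lintegral_indicator hs]
  have := lintegral_comp_linearMap μ hf (hF.indicator hs)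
  have h2 : (f ⁻¹' s).indicator (fun x => F (f x)) = fun x => s.indicator F (f x) := by
    rfl
  rw [h2, this, ← mul_assoc, ← ENNReal.ofReal_mul (abs_nonneg _), ← abs_mul, mul_inv_cancel₀ hf]
  simp

/-! ### Full rank of Gaussian matrices, and Gaussian laws with a covariance matrix. -/

section MatrixOrder

open scoped MatrixOrder

/-- The matrix whose rows are the given vectors. -/
def rowMatrix {N d : ℕ} (g : Fin N → EuclideanSpace ℝ (Fin d)) : Matrix (Fin N) (Fin d) ℝ :=
  Matrix.of fun i k => g i k

@[fun_prop]
theorem continuous_rowMatrix {N d : ℕ} :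
    Continuous (rowMatrix : (Fin N → EuclideanSpace ℝ (Fin d)) → Matrix (Fin N) (Fin d) ℝ) := by
  unfold rowMatrix
  refine continuous_matrix fun i k => ?_
  simp only [Matrix.of_apply]
  fun_prop

theorem continuous_det_gram {N d : ℕ} :
    Continuous fun g : Fin N → EuclideanSpace ℝ (Fin d) =>
      ((rowMatrix g)ᵀ * rowMatrix g).det := by
  fun_prop

theorem posDef_transpose_mul_self {m n : Type*} [Fintype m] [Fintype n]
    {M : Matrix m n ℝ} (hM : Function.Injective M.mulVec) : (Mᵀ * M).PosDef := by
  simpa [Matrix.conjTranspose_eq_transpose_of_trivial] using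
    Matrix.PosDef.conjTranspose_mul_self M hM

/-- As a function of `t` the determinant is the characteristic polynomial of `-A`, which is monic
and so has finitely many roots. -/
theorem ae_det_add_smul_one_ne_zero {n : Type*} [Fintype n] [DecidableEq n] (A : Matrix n n ℝ) :
    ∀ᵐ t : ℝ, (A + t • (1 : Matrix n n ℝ)).det ≠ 0 := by
  have hfin : {t : ℝ | (-A).charpoly.IsRoot t}.Finite :=
    Polynomial.finite_setOfPred_isRoot (Matrix.charpoly_monic _).ne_zero
  filter_upwards [hfin.countable.ae_notMem volume] with t ht h
  apply ht
  simp only [Polynomial.IsRoot, Matrix.eval_charpoly]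
  rw [← h]
  congr 1
  rw [sub_neg_eq_add, add_comm, Matrix.scalar_apply, Matrix.smul_one_eq_diagonal]

/-- It is enough that the top `d × d` block is invertible. Moving `g` along the direction `e` adds
`t • 1` to that block, so each line parallel to `e` meets the singular set in a null set, and Fubini
concludes. -/
theorem ae_injective_rowMatrix {N d : ℕ} (hdN : d ≤ N) :
    ∀ᵐ g : Fin N → EuclideanSpace ℝ (Fin d), Function.Injective (rowMatrix g).mulVec := by
  let e : Fin N → EuclideanSpace ℝ (Fin d) :=
    fun i => WithLp.toLp 2 fun k => if i = Fin.castLE hdN k then 1 else 0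
  have hs : MeasurableSet {g : Fin N → EuclideanSpace ℝ (Fin d) |
      ((rowMatrix g).submatrix (Fin.castLE hdN) id).det ≠ 0} :=
    (isOpen_ne_fun (by fun_prop) continuous_const).measurableSet
  have key := ae_mem_of_ae_add_linearMap_mem (LinearMap.toSpanSingleton ℝ _ e) volume volume hs
    (fun y => by
      filter_upwards [ae_det_add_smul_one_ne_zero
        ((rowMatrix y).submatrix (Fin.castLE hdN) id)] with t ht
      convert ht using 2
      ext i k
      simp [rowMatrix, e, Matrix.one_apply])
  filter_upwards [key] with g hg
  rw [← Matrix.coe_mulVecLin, ← LinearMap.ker_eq_bot, LinearMap.ker_eq_bot']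
  intro v hv
  by_contra hv0
  refine hg (Matrix.exists_mulVec_eq_zero_iff.1 ⟨v, hv0, ?_⟩)
  ext i
  simpa [Matrix.mulVec, dotProduct] using congrFun hv (Fin.castLE hdN i)

theorem ae_injective_rowMatrix_gaussian {N d : ℕ} (hdN : d ≤ N) :
    ∀ᵐ g ∂Measure.pi (fun _ : Fin N => stdGaussian (EuclideanSpace ℝ (Fin d))),
      Function.Injective (rowMatrix g).mulVec := by
  rw [pi_stdGaussian_eq_withDensity]
  exact (withDensity_absolutelyContinuous _ _).ae_le (ae_injective_rowMatrix hdN)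

theorem dotProduct_inv_mulVec_of_mul_transpose {n : Type*} [Fintype n] [DecidableEq n]
    {R A : Matrix n n ℝ} (hRA : R * Rᵀ = A) (hA : A.det ≠ 0) (x : n → ℝ) :
    (R *ᵥ x) ⬝ᵥ (A⁻¹ *ᵥ (R *ᵥ x)) = x ⬝ᵥ x := by
  have hR : IsUnit R.det := by
    rw [isUnit_iff_ne_zero]; rintro h; apply hA; rw [← hRA, Matrix.det_mul, h, zero_mul]
  have hRt : IsUnit Rᵀ.det := by rwa [Matrix.det_transpose]
  rw [Matrix.mulVec_mulVec, ← hRA, Matrix.mul_inv_rev, Matrix.mul_assoc,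
    Matrix.nonsing_inv_mul _ hR, Matrix.mul_one, dotProduct_comm, Matrix.dotProduct_mulVec,
    ← Matrix.mulVec_transpose, Matrix.mulVec_mulVec, Matrix.mul_nonsing_inv _ hRt,
    Matrix.one_mulVec]

theorem sqrt_mul_transpose_sqrt {n : Type*} [Fintype n] [DecidableEq n]
    {A : Matrix n n ℝ} (hA : A.PosSemidef) : CFC.sqrt A * (CFC.sqrt A)ᵀ = A := by
  have h : (CFC.sqrt A)ᵀ = CFC.sqrt A := (CFC.sqrt_nonneg A).isSelfAdjoint
  rw [h]
  exact CFC.sqrt_mul_sqrt_self _ hA.nonneg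

theorem abs_det_of_mul_transpose {n : Type*} [Fintype n] [DecidableEq n]
    {R A : Matrix n n ℝ} (hRA : R * Rᵀ = A) : |R.det| = √A.det := by
  rw [← hRA, Matrix.det_mul, Matrix.det_transpose, Real.sqrt_mul_self_eq_abs]

theorem det_ne_zero_of_mul_transpose {n : Type*} [Fintype n] [DecidableEq n]
    {R A : Matrix n n ℝ} (hRA : R * Rᵀ = A) (hA : A.PosDef) : R.det ≠ 0 := by
  rw [← abs_pos, abs_det_of_mul_transpose hRA]; exact Real.sqrt_pos.2 hA.det_pos

theorem det_toEuclideanLin {n : Type*} [Fintype n] [DecidableEq n] (R : Matrix n n ℝ) :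
    LinearMap.det (Matrix.toEuclideanLin R) = R.det := by
  rw [← LinearMap.det_toLin' R, ← LinearMap.det_conj (Matrix.toLin' R)
    (WithLp.linearEquiv 2 ℝ (n → ℝ)).symm]
  rfl

theorem norm_sq_eq_dotProduct {n : Type*} [Fintype n] (x : EuclideanSpace ℝ n) :
    ‖x‖ ^ 2 = x.ofLp ⬝ᵥ x.ofLp := by
  rw [EuclideanSpace.real_norm_sq_eq]; simp [dotProduct, sq]

theorem multivariateGaussian_eq_withDensity {d : ℕ} {A : Matrix (Fin d) (Fin d) ℝ}
    (hA : A.PosDef) :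
    multivariateGaussian 0 A = volume.withDensity fun x => ENNReal.ofReal
      ((√(2 * Real.pi))⁻¹ ^ d * (√A.det)⁻¹ *
        Real.exp (-(x.ofLp ⬝ᵥ (A⁻¹ *ᵥ x.ofLp) / 2))) := by
  have hR := sqrt_mul_transpose_sqrt hA.posSemidef
  have hdet := det_ne_zero_of_mul_transpose hR hA
  have hF : Measurable fun x : EuclideanSpace ℝ (Fin d) => ENNReal.ofReal
      ((√(2 * Real.pi))⁻¹ ^ d * (√A.det)⁻¹ *
        Real.exp (-(x.ofLp ⬝ᵥ (A⁻¹ *ᵥ x.ofLp) / 2))) := by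
    simp only [dotProduct, Matrix.mulVec]
    fun_prop
  have hf : LinearMap.det (Matrix.toEuclideanLin (CFC.sqrt A)) ≠ 0 := by
    rwa [det_toEuclideanLin]
  have key := map_linearMap_withDensity volume hf hF
  rw [← key, multivariateGaussian, stdGaussian_eq_withDensity]
  congr 1
  · ext1 x
    rw [zero_add]
    rfl
  · congr 1
    ext x
    rw [det_toEuclideanLin, ← ENNReal.ofReal_mul (abs_nonneg _)]
    congr 1
    have h := dotProduct_inv_mulVec_of_mul_transpose hR hA.det_pos.ne' x.ofLp
    rw [show (Matrix.toEuclideanLin (CFC.sqrt A) x).ofLp = CFC.sqrt A *ᵥ x.ofLp from rfl, h,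
      abs_det_of_mul_transpose hR, stdGaussianPDF, norm_sq_eq_dotProduct]
    have : √A.det ≠ 0 := (Real.sqrt_pos.2 hA.det_pos).ne'
    field_simp

/-- Characteristic functions are used because `B` may be rectangular and the image law degenerate,
so that a density argument would not cover it. -/
theorem map_mulVec_stdGaussian {m n : Type*} [Fintype m] [Fintype n] [DecidableEq m]
    [DecidableEq n] (B : Matrix n m ℝ) :
    (stdGaussian (EuclideanSpace ℝ m)).map (fun e => WithLp.toLp 2 (B *ᵥ e.ofLp)) =
      multivariateGaussian 0 (B * Bᵀ) := by
  have hm : Measurable fun e : EuclideanSpace ℝ m => WithLp.toLp 2 (B *ᵥ e.ofLp) :=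
    (Matrix.toEuclideanLin B).continuous_of_finiteDimensional.measurable
  have hB : (B * Bᵀ).PosSemidef := by
    simpa [Matrix.conjTranspose_eq_transpose_of_trivial] using
      Matrix.posSemidef_self_mul_conjTranspose B
  have := Measure.isProbabilityMeasure_map (μ := stdGaussian (EuclideanSpace ℝ m)) hm.aemeasurable
  apply Measure.ext_of_charFun
  ext t
  have h1 : charFun ((stdGaussian (EuclideanSpace ℝ m)).map
      (fun e => WithLp.toLp 2 (B *ᵥ e.ofLp))) t =
      charFun (stdGaussian (EuclideanSpace ℝ m)) (WithLp.toLp 2 (Bᵀ *ᵥ t.ofLp)) := by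
    rw [charFun_apply, charFun_apply, integral_map hm.aemeasurable (by fun_prop)]
    congr 1
    ext e
    congr 3
    simp only [EuclideanSpace.inner_eq_star_dotProduct, star_trivial]
    rw [Matrix.dotProduct_mulVec, Matrix.mulVec_transpose]
  rw [h1, charFun_stdGaussian, charFun_multivariateGaussian hB]
  congr 1
  rw [← Complex.ofReal_pow, norm_sq_eq_dotProduct]
  simp only [inner_zero_right, Complex.ofReal_zero, zero_mul, zero_sub]
  rw [← Matrix.mulVec_mulVec, Matrix.dotProduct_mulVec (t.ofLp) B, ← Matrix.mulVec_transpose,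
    neg_div]

end MatrixOrder

/-! ### Averaging over the Gaussian design. -/

theorem exists_det_eq_sqrt_one_add {n : Type*} [Fintype n] [DecidableEq n] (x : n → ℝ) :
    ∃ T : Matrix n n ℝ, T.det = √(1 + x ⬝ᵥ x) ∧
      ∀ v, (T *ᵥ v) ⬝ᵥ (T *ᵥ v) = v ⬝ᵥ v + (x ⬝ᵥ v) ^ 2 := by
  set r := √(1 + x ⬝ᵥ x) with hr
  have hx0 : 0 ≤ x ⬝ᵥ x := dotProduct_self_star_nonneg x
  have hr2 : x ⬝ᵥ x = r ^ 2 - 1 := by rw [hr, Real.sq_sqrt (by linarith)]; ring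
  have hr0 : 0 ≤ r := Real.sqrt_nonneg _
  have hr1 : 1 + r ≠ 0 := by positivity
  -- The witness is the positive square root of `1 + x xᵀ`: it fixes the complement of `x` and
  -- scales `x` by `1 + (r² - 1)/(1 + r) = r`.
  refine ⟨1 + Matrix.replicateCol Unit ((1 + r)⁻¹ • x) * Matrix.replicateRow Unit x, ?_, ?_⟩
  · rw [Matrix.det_one_add_replicateCol_mul_replicateRow, dotProduct_smul, hr2, smul_eq_mul]
    field_simp
    ring
  · intro v
    have : (1 + Matrix.replicateCol Unit ((1 + r)⁻¹ • x) * Matrix.replicateRow Unit x) *ᵥ v =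
        v + ((1 + r)⁻¹ * (x ⬝ᵥ v)) • x := by
      ext i
      simp only [Matrix.add_mulVec, Matrix.one_mulVec, ← Matrix.mulVec_mulVec]
      simp only [Matrix.mulVec, dotProduct, Matrix.replicateCol_apply, Matrix.replicateRow_apply,
        Pi.add_apply, Pi.smul_apply, smul_eq_mul, Finset.univ_unique, Finset.sum_singleton]
      ring
    rw [this]
    simp only [add_dotProduct, dotProduct_add, smul_dotProduct, dotProduct_smul, smul_eq_mul]
    rw [hr2, dotProduct_comm v x]
    field_simp
    ring

theorem rowMatrix_mulVec_dotProduct_self {N d : ℕ} (g : Fin N → EuclideanSpace ℝ (Fin d))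
    (x : Fin d → ℝ) :
    (rowMatrix g *ᵥ x) ⬝ᵥ (rowMatrix g *ᵥ x) = ∑ i, (x ⬝ᵥ (g i).ofLp) ^ 2 := by
  simp [rowMatrix, Matrix.mulVec, dotProduct, sq, mul_comm]

/-- The exponential turns the product of densities at `g` into the product at `f g`, where `f`
applies `T` to every row. Since `det f = (det T)ᴺ` and the root of the Gram determinant scales by
`det T`, the substitution yields `(det T)^(-(N+1))`; this is the source of the exponent `(N+1)/2`.
-/
theorem lintegral_sqrt_det_gram_mul_exp {N d : ℕ} (x : EuclideanSpace ℝ (Fin d)) :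
    ∫⁻ g : Fin N → EuclideanSpace ℝ (Fin d), ENNReal.ofReal
        (√((rowMatrix g)ᵀ * rowMatrix g).det * (∏ i, stdGaussianPDF (g i)) *
          Real.exp (-((rowMatrix g *ᵥ x.ofLp) ⬝ᵥ (rowMatrix g *ᵥ x.ofLp) / 2))) =
      ENNReal.ofReal ((1 + ‖x‖ ^ 2) ^ (-(((N : ℝ) + 1) / 2))) *
        ∫⁻ g : Fin N → EuclideanSpace ℝ (Fin d), ENNReal.ofReal
          (√((rowMatrix g)ᵀ * rowMatrix g).det * ∏ i, stdGaussianPDF (g i)) := by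
  obtain ⟨T, hT, hTv⟩ := exists_det_eq_sqrt_one_add x.ofLp
  rw [← norm_sq_eq_dotProduct] at hT
  have hpos : 0 < 1 + ‖x‖ ^ 2 := by positivity
  have hTpos : 0 < T.det := by rw [hT]; exact Real.sqrt_pos.2 hpos
  let f : (Fin N → EuclideanSpace ℝ (Fin d)) →ₗ[ℝ] Fin N → EuclideanSpace ℝ (Fin d) :=
    LinearMap.pi fun i => (Matrix.toEuclideanLin T).comp (LinearMap.proj i)
  have hf : LinearMap.det f = T.det ^ N := by
    simp only [f, LinearMap.det_pi, det_toEuclideanLin]; simp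
  have hfr : ∀ g, rowMatrix (f g) = rowMatrix g * Tᵀ := by
    intro g; ext i k
    simp [rowMatrix, f, Matrix.mul_apply, Matrix.mulVec, dotProduct, mul_comm]
  have hdet : ∀ g, √((rowMatrix (f g))ᵀ * rowMatrix (f g)).det =
      T.det * √((rowMatrix g)ᵀ * rowMatrix g).det := by
    intro g
    rw [hfr, Matrix.transpose_mul, Matrix.transpose_transpose, Matrix.mul_assoc,
      ← Matrix.mul_assoc _ _ Tᵀ, Matrix.det_mul, Matrix.det_mul, Matrix.det_transpose,
      mul_comm _ T.det, ← mul_assoc, Real.sqrt_mul (mul_self_nonneg _),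
      Real.sqrt_mul_self hTpos.le]
  have hprod : ∀ g, ∏ i, stdGaussianPDF (f g i) = (∏ i, stdGaussianPDF (g i)) *
      Real.exp (-((rowMatrix g *ᵥ x.ofLp) ⬝ᵥ (rowMatrix g *ᵥ x.ofLp) / 2)) := by
    intro g
    rw [rowMatrix_mulVec_dotProduct_self, Finset.sum_div, ← Finset.sum_neg_distrib, Real.exp_sum,
      ← Finset.prod_mul_distrib]
    refine Finset.prod_congr rfl fun i _ => ?_
    have : ‖f g i‖ ^ 2 = ‖g i‖ ^ 2 + (x.ofLp ⬝ᵥ (g i).ofLp) ^ 2 := by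
      rw [norm_sq_eq_dotProduct, norm_sq_eq_dotProduct, ← hTv]
      rfl
    rw [stdGaussianPDF, stdGaussianPDF, this, mul_assoc, ← Real.exp_add]
    ring_nf
  have hm : Measurable fun g : Fin N → EuclideanSpace ℝ (Fin d) =>
      ENNReal.ofReal (√((rowMatrix g)ᵀ * rowMatrix g).det * ∏ i, stdGaussianPDF (g i)) := by
    have := (continuous_det_gram (N := N) (d := d)).measurable
    fun_prop
  have key := lintegral_comp_linearMap volume (f := f) (by rw [hf]; positivity) hm
  simp_rw [hdet, hprod] at key
  rw [hf] at key
  have hTd : ENNReal.ofReal T.det⁻¹ * ENNReal.ofReal T.det = 1 := by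
    rw [← ENNReal.ofReal_mul (by positivity), inv_mul_cancel₀ hTpos.ne', ENNReal.ofReal_one]
  have hl : ∀ g : Fin N → EuclideanSpace ℝ (Fin d), ENNReal.ofReal
        (√((rowMatrix g)ᵀ * rowMatrix g).det * (∏ i, stdGaussianPDF (g i)) *
          Real.exp (-((rowMatrix g *ᵥ x.ofLp) ⬝ᵥ (rowMatrix g *ᵥ x.ofLp) / 2))) =
      ENNReal.ofReal T.det⁻¹ * ENNReal.ofReal
        (T.det * √((rowMatrix g)ᵀ * rowMatrix g).det * ((∏ i, stdGaussianPDF (g i)) *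
          Real.exp (-((rowMatrix g *ᵥ x.ofLp) ⬝ᵥ (rowMatrix g *ᵥ x.ofLp) / 2)))) := by
    intro g
    rw [mul_assoc T.det, ENNReal.ofReal_mul hTpos.le, ← mul_assoc, hTd, one_mul, mul_assoc]
  simp_rw [hl]
  rw [lintegral_const_mul' _ _ ENNReal.ofReal_ne_top, key, ← mul_assoc,
    ← ENNReal.ofReal_mul (by positivity)]
  congr 2
  rw [abs_of_pos (by positivity), hT, ← inv_pow, ← pow_succ', Real.sqrt_eq_rpow,
    ← Real.rpow_neg hpos.le, ← Real.rpow_natCast, ← Real.rpow_mul hpos.le]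
  congr 1
  push_cast
  ring

/-! ### Law of the estimator for standard Gaussian data, up to a constant. -/

theorem measurable_mlEstimator {N d : ℕ} :
    Measurable fun p : (Fin N → EuclideanSpace ℝ (Fin d)) × EuclideanSpace ℝ (Fin N) =>
      mlEstimator (rowMatrix p.1) p.2 := by
  unfold mlEstimator
  refine (WithLp.measurable_toLp 2 _).comp (measurable_pi_lambda _ fun k => ?_)
  -- Inverse determinant times adjugate is measurable on all matrices, including singular ones,
  -- where the convention `0⁻¹ = 0` applies.
  simp only [Matrix.mulVec, dotProduct, Matrix.inv_def, Matrix.smul_apply, Ring.inverse_eq_inv',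
    smul_eq_mul]
  have h1 : Measurable fun p : (Fin N → EuclideanSpace ℝ (Fin d)) × EuclideanSpace ℝ (Fin N) =>
      ((rowMatrix p.1)ᵀ * rowMatrix p.1).det :=
    (continuous_det_gram (N := N) (d := d)).measurable.comp measurable_fst
  have h2 : ∀ i, Measurable
      fun p : (Fin N → EuclideanSpace ℝ (Fin d)) × EuclideanSpace ℝ (Fin N) =>
      ((rowMatrix p.1)ᵀ * rowMatrix p.1).adjugate k i := by
    intro i
    have : Continuous fun p : (Fin N → EuclideanSpace ℝ (Fin d)) × EuclideanSpace ℝ (Fin N) =>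
        ((rowMatrix p.1)ᵀ * rowMatrix p.1).adjugate := by fun_prop
    exact (this.matrix_elem k i).measurable
  refine Finset.measurable_sum _ fun i _ => (h1.inv.mul (h2 i)).mul ?_
  simp only [rowMatrix, Matrix.transpose_apply, Matrix.of_apply]
  fun_prop

/-- The density of the least squares estimator for the design `M` when the responses are
independent standard Gaussian variables. -/
noncomputable def leastSquaresPDF {N d : ℕ} (M : Matrix (Fin N) (Fin d) ℝ)
    (x : EuclideanSpace ℝ (Fin d)) : ℝ :=
  (√(2 * Real.pi))⁻¹ ^ d * √(Mᵀ * M).det * Real.exp (-((M *ᵥ x.ofLp) ⬝ᵥ (M *ᵥ x.ofLp) / 2))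

theorem measurable_leastSquaresPDF_rowMatrix {N d : ℕ} :
    Measurable fun p : (Fin N → EuclideanSpace ℝ (Fin d)) × EuclideanSpace ℝ (Fin d) =>
      leastSquaresPDF (rowMatrix p.1) p.2 := by
  simp only [leastSquaresPDF, rowMatrix_mulVec_dotProduct_self]
  simp only [dotProduct]
  have : Measurable fun p : (Fin N → EuclideanSpace ℝ (Fin d)) × EuclideanSpace ℝ (Fin d) =>
      ((rowMatrix p.1)ᵀ * rowMatrix p.1).det :=
    (continuous_det_gram (N := N) (d := d)).measurable.comp measurable_fst
  fun_prop

/-- The estimator is the linear map `B = (MᵀM)⁻¹Mᵀ`, and `B Bᵀ = (MᵀM)⁻¹`, so the image law is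
Gaussian with precision matrix `MᵀM`. -/
theorem map_mlEstimator_stdGaussian {N d : ℕ} {M : Matrix (Fin N) (Fin d) ℝ}
    (hM : Function.Injective M.mulVec) :
    (stdGaussian (EuclideanSpace ℝ (Fin N))).map (mlEstimator M) =
      volume.withDensity fun x => ENNReal.ofReal (leastSquaresPDF M x) := by
  have hpd := posDef_transpose_mul_self hM
  have hu : IsUnit (Mᵀ * M).det := hpd.det_pos.ne'.isUnit
  have hB : ((Mᵀ * M)⁻¹ * Mᵀ) * ((Mᵀ * M)⁻¹ * Mᵀ)ᵀ = (Mᵀ * M)⁻¹ := by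
    have hsymm : (Mᵀ * M)ᵀ = Mᵀ * M := by simp
    rw [Matrix.transpose_mul, Matrix.transpose_transpose, Matrix.transpose_nonsing_inv, hsymm,
      Matrix.mul_assoc, ← Matrix.mul_assoc Mᵀ, Matrix.mul_nonsing_inv _ hu, Matrix.mul_one]
  have hfun : (mlEstimator M : EuclideanSpace ℝ (Fin N) → _) =
      fun e => WithLp.toLp 2 (((Mᵀ * M)⁻¹ * Mᵀ) *ᵥ e.ofLp) := by
    ext1 e; rw [mlEstimator, Matrix.mulVec_mulVec]
  rw [hfun, map_mulVec_stdGaussian, hB, multivariateGaussian_eq_withDensity hpd.inv]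
  congr 1
  ext x
  rw [leastSquaresPDF, Matrix.nonsing_inv_nonsing_inv _ hu, Matrix.det_nonsing_inv,
    Ring.inverse_eq_inv', Real.sqrt_inv, inv_inv, ← Matrix.mulVec_mulVec, Matrix.dotProduct_mulVec,
    Matrix.vecMul_transpose]

theorem lintegral_leastSquaresPDF_rowMatrix {N d : ℕ} (x : EuclideanSpace ℝ (Fin d)) :
    ∫⁻ g, ENNReal.ofReal (leastSquaresPDF (rowMatrix g) x)
        ∂(Measure.pi fun _ : Fin N => stdGaussian (EuclideanSpace ℝ (Fin d))) =
      (ENNReal.ofReal ((√(2 * Real.pi))⁻¹ ^ d) *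
        ∫⁻ g : Fin N → EuclideanSpace ℝ (Fin d), ENNReal.ofReal
          (√((rowMatrix g)ᵀ * rowMatrix g).det * ∏ i, stdGaussianPDF (g i))) *
        ENNReal.ofReal ((1 + ‖x‖ ^ 2) ^ (-(((N : ℝ) + 1) / 2))) := by
  have hd0 : (0 : ℝ) ≤ (√(2 * Real.pi))⁻¹ ^ d := by positivity
  have hkx : Measurable fun g : Fin N → EuclideanSpace ℝ (Fin d) =>
      ENNReal.ofReal (leastSquaresPDF (rowMatrix g) x) :=
    (measurable_leastSquaresPDF_rowMatrix.comp
      (measurable_prodMk_right (y := x))).ennreal_ofReal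
  rw [pi_stdGaussian_eq_withDensity,
    lintegral_withDensity_eq_lintegral_mul _ (by fun_prop) hkx, mul_assoc,
    mul_comm (lintegral _ _), ← lintegral_sqrt_det_gram_mul_exp,
    ← lintegral_const_mul' _ _ ENNReal.ofReal_ne_top]
  refine lintegral_congr fun g => ?_
  have hp0 : 0 ≤ ∏ i, stdGaussianPDF (g i) :=
    Finset.prod_nonneg fun i _ => stdGaussianPDF_nonneg _
  simp only [Pi.mul_apply]
  rw [← ENNReal.ofReal_mul hp0, ← ENNReal.ofReal_mul hd0, leastSquaresPDF]
  congr 1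
  ring

/-- The marginal density is the average of the conditional densities, by Tonelli; it is applied with
the design as `a` and the noise as `b`. -/
theorem map_prod_eq_withDensity_lintegral {α β γ : Type*} [MeasurableSpace α]
    [MeasurableSpace β] [MeasurableSpace γ] {μ : Measure α} {ν : Measure β} {ρ : Measure γ}
    [SFinite μ] [SFinite ν] [SFinite ρ] {Y : α × β → γ} (hY : Measurable Y)
    {f : α → γ → ENNReal} (hf : Measurable (Function.uncurry f))
    (h : ∀ᵐ a ∂μ, ν.map (fun b => Y (a, b)) = ρ.withDensity (f a)) :
    (μ.prod ν).map Y = ρ.withDensity fun x => ∫⁻ a, f a x ∂μ := by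
  ext s hs
  rw [Measure.map_apply hY hs, Measure.prod_apply (hY hs), withDensity_apply _ hs,
    ← lintegral_lintegral_swap hf.aemeasurable]
  refine lintegral_congr_ae ?_
  filter_upwards [h] with a ha
  rw [← withDensity_apply _ hs, ← ha, Measure.map_apply (by fun_prop) hs]
  rfl

/-- Letting `C` be an extended real avoids computing, or even bounding, the mean of `√det(GᵀG)`. -/
theorem exists_map_mlEstimator_eq_withDensity {N d : ℕ} (hdN : d ≤ N) :
    ∃ C : ENNReal, ((Measure.pi fun _ : Fin N => stdGaussian (EuclideanSpace ℝ (Fin d))).prod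
        (stdGaussian (EuclideanSpace ℝ (Fin N)))).map
          (fun p => mlEstimator (rowMatrix p.1) p.2) =
      volume.withDensity fun x : EuclideanSpace ℝ (Fin d) =>
        C * ENNReal.ofReal ((1 + ‖x‖ ^ 2) ^ (-(((N : ℝ) + 1) / 2))) := by
  refine ⟨ENNReal.ofReal ((√(2 * Real.pi))⁻¹ ^ d) *
    ∫⁻ g : Fin N → EuclideanSpace ℝ (Fin d), ENNReal.ofReal
      (√((rowMatrix g)ᵀ * rowMatrix g).det * ∏ i, stdGaussianPDF (g i)), ?_⟩
  rw [map_prod_eq_withDensity_lintegral measurable_mlEstimator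
    (f := fun g x => ENNReal.ofReal (leastSquaresPDF (rowMatrix g) x)) (ρ := volume)
    measurable_leastSquaresPDF_rowMatrix.ennreal_ofReal]
  · simp_rw [lintegral_leastSquaresPDF_rowMatrix]
  · filter_upwards [ae_injective_rowMatrix_gaussian hdN] with g hg
    exact map_mlEstimator_stdGaussian hg

/-! ### Radial integrals and the normalising constant. -/

theorem lintegral_rpow_mul_exp_neg_mul_Ioi {a r : ℝ} (ha : 0 < a) (hr : 0 < r) :
    ∫⁻ t in Set.Ioi 0, ENNReal.ofReal (t ^ (a - 1) * Real.exp (-(r * t))) =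
      ENNReal.ofReal ((1 / r) ^ a * Real.Gamma a) := by
  have hΓ := Real.Gamma_pos_of_pos ha
  have h := Real.integral_rpow_mul_exp_neg_mul_Ioi ha hr
  rw [← h, ofReal_integral_eq_lintegral_ofReal]
  · refine Integrable.of_integral_ne_zero ?_
    rw [h]; positivity
  · filter_upwards [ae_restrict_mem measurableSet_Ioi] with t ht
    have := Set.mem_Ioi.1 ht
    simp only [Pi.zero_apply]
    positivity

theorem lintegral_exp_neg_mul_norm_sq {d : ℕ} {b : ℝ} (hb : 0 < b) :
    ∫⁻ x : EuclideanSpace ℝ (Fin d), ENNReal.ofReal (Real.exp (-b * ‖x‖ ^ 2)) =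
      ENNReal.ofReal ((Real.pi / b) ^ ((d : ℝ) / 2)) := by
  have h := GaussianFourier.integral_rexp_neg_mul_sq_norm (V := EuclideanSpace ℝ (Fin d)) hb
  rw [finrank_euclideanSpace_fin] at h
  rw [← h, ofReal_integral_eq_lintegral_ofReal]
  · refine Integrable.of_integral_ne_zero ?_
    rw [h]; positivity
  · exact ae_of_all _ fun x => (Real.exp_pos _).le

/-- The power is a Gamma integral of `exp(-(1 + ‖x‖²) t)`. After Tonelli the inner integral is
Gaussian and contributes `(π / t)^(d/2)`, which leaves a Gamma integral with parameter `a - d/2 >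
0`. -/
theorem lintegral_one_add_norm_sq_rpow_neg {d : ℕ} {a : ℝ} (ha : (d : ℝ) / 2 < a) :
    ∫⁻ x : EuclideanSpace ℝ (Fin d), ENNReal.ofReal ((1 + ‖x‖ ^ 2) ^ (-a)) =
      ENNReal.ofReal (Real.pi ^ ((d : ℝ) / 2) * Real.Gamma (a - d / 2) / Real.Gamma a) := by
  have hd0 : (0 : ℝ) ≤ d / 2 := by positivity
  have ha0 : 0 < a := hd0.trans_lt ha
  have hΓ := Real.Gamma_pos_of_pos ha0
  have h1 : ∀ x : EuclideanSpace ℝ (Fin d), ENNReal.ofReal ((1 + ‖x‖ ^ 2) ^ (-a)) =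
      ENNReal.ofReal (Real.Gamma a)⁻¹ * ∫⁻ t in Set.Ioi 0, ENNReal.ofReal
        (t ^ (a - 1) * Real.exp (-((1 + ‖x‖ ^ 2) * t))) := by
    intro x
    have hx : 0 < 1 + ‖x‖ ^ 2 := by positivity
    rw [lintegral_rpow_mul_exp_neg_mul_Ioi ha0 hx, ← ENNReal.ofReal_mul (by positivity)]
    congr 1
    rw [one_div, Real.inv_rpow hx.le, Real.rpow_neg hx.le]
    field_simp
  have h2 : ∀ t ∈ Set.Ioi (0 : ℝ), ∫⁻ x : EuclideanSpace ℝ (Fin d), ENNReal.ofReal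
        (t ^ (a - 1) * Real.exp (-((1 + ‖x‖ ^ 2) * t))) =
      ENNReal.ofReal (Real.pi ^ ((d : ℝ) / 2)) * ENNReal.ofReal
        (t ^ ((a - d / 2) - 1) * Real.exp (-(1 * t))) := by
    intro t ht
    have ht : 0 < t := ht
    have : ∀ x : EuclideanSpace ℝ (Fin d), ENNReal.ofReal
        (t ^ (a - 1) * Real.exp (-((1 + ‖x‖ ^ 2) * t))) =
        ENNReal.ofReal (t ^ (a - 1) * Real.exp (-t)) *
          ENNReal.ofReal (Real.exp (-t * ‖x‖ ^ 2)) := by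
      intro x
      rw [← ENNReal.ofReal_mul (by positivity), mul_assoc, ← Real.exp_add]
      ring_nf
    simp_rw [this]
    rw [lintegral_const_mul' _ _ ENNReal.ofReal_ne_top, lintegral_exp_neg_mul_norm_sq ht,
      ← ENNReal.ofReal_mul (by positivity), ← ENNReal.ofReal_mul (by positivity)]
    congr 1
    rw [Real.div_rpow Real.pi_pos.le ht.le, show a - d / 2 - 1 = (a - 1) - d / 2 by ring,
      Real.rpow_sub ht (a - 1), one_mul]
    ring
  have hΓ' := Real.Gamma_pos_of_pos (sub_pos.2 ha)
  simp_rw [h1]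
  rw [lintegral_const_mul' _ _ ENNReal.ofReal_ne_top, lintegral_lintegral_swap,
    setLIntegral_congr_fun measurableSet_Ioi h2, lintegral_const_mul' _ _ ENNReal.ofReal_ne_top,
    lintegral_rpow_mul_exp_neg_mul_Ioi (sub_pos.2 ha) one_pos,
    ← ENNReal.ofReal_mul (by positivity), ← ENNReal.ofReal_mul (by positivity)]
  · congr 1
    simp
    field_simp
  · exact Measurable.aemeasurable (by unfold Function.uncurry; fun_prop)

theorem integrable_one_add_norm_sq_rpow_neg {d : ℕ} {a : ℝ} (ha : (d : ℝ) / 2 < a) :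
    Integrable fun x : EuclideanSpace ℝ (Fin d) => (1 + ‖x‖ ^ 2) ^ (-a) := by
  have h := integrable_rpow_neg_one_add_norm_sq (E := EuclideanSpace ℝ (Fin d)) (μ := volume)
    (r := 2 * a) (by rw [finrank_euclideanSpace_fin]; linarith)
  simpa [neg_div] using h

theorem integral_one_add_norm_sq_rpow_neg {d : ℕ} {a : ℝ} (ha : (d : ℝ) / 2 < a) :
    ∫ x : EuclideanSpace ℝ (Fin d), (1 + ‖x‖ ^ 2) ^ (-a) =
      Real.pi ^ ((d : ℝ) / 2) * Real.Gamma (a - d / 2) / Real.Gamma a := by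
  have hd0 : (0 : ℝ) ≤ d / 2 := by positivity
  have hΓ := Real.Gamma_pos_of_pos (hd0.trans_lt ha)
  have hΓ' := Real.Gamma_pos_of_pos (sub_pos.2 ha)
  rw [integral_eq_lintegral_of_nonneg_ae (ae_of_all _ fun x => by positivity)
    (integrable_one_add_norm_sq_rpow_neg ha).aestronglyMeasurable,
    lintegral_one_add_norm_sq_rpow_neg ha, ENNReal.toReal_ofReal (by positivity)]

/-- The density of `(√ν)⁻¹ T`, where `T` has the standard Student t-distribution with `ν` degrees
of freedom. -/
noncomputable def scaledStudentTPDF {d : ℕ} (ν : ℝ) (x : EuclideanSpace ℝ (Fin d)) : ℝ :=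
  Real.Gamma ((ν + d) / 2) / (Real.Gamma (ν / 2) * Real.pi ^ ((d : ℝ) / 2)) *
    (1 + ‖x‖ ^ 2) ^ (-((ν + d) / 2))

theorem scaledStudentTPDF_nonneg {d : ℕ} {ν : ℝ} (hν : 0 < ν) (x : EuclideanSpace ℝ (Fin d)) :
    0 ≤ scaledStudentTPDF ν x := by
  have := Real.Gamma_pos_of_pos (show 0 < (ν + d) / 2 by positivity)
  have := Real.Gamma_pos_of_pos (show 0 < ν / 2 by positivity)
  unfold scaledStudentTPDF
  positivity

@[fun_prop]
theorem measurable_scaledStudentTPDF {d : ℕ} {ν : ℝ} :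
    Measurable (scaledStudentTPDF ν : EuclideanSpace ℝ (Fin d) → ℝ) := by
  unfold scaledStudentTPDF; fun_prop

theorem withDensity_eq_scaledStudentT {d : ℕ} {ν : ℝ} (hν : 0 < ν) {C : ENNReal}
    (h : (volume.withDensity fun x : EuclideanSpace ℝ (Fin d) =>
      C * ENNReal.ofReal ((1 + ‖x‖ ^ 2) ^ (-((ν + d) / 2)))) Set.univ = 1) :
    (volume.withDensity fun x : EuclideanSpace ℝ (Fin d) =>
      C * ENNReal.ofReal ((1 + ‖x‖ ^ 2) ^ (-((ν + d) / 2)))) =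
    volume.withDensity fun x => ENNReal.ofReal (scaledStudentTPDF ν x) := by
  have h1 := Real.Gamma_pos_of_pos (show 0 < (ν + d) / 2 by positivity)
  have h2 := Real.Gamma_pos_of_pos (show 0 < ν / 2 by positivity)
  rw [withDensity_apply _ MeasurableSet.univ, Measure.restrict_univ,
    lintegral_const_mul _ (by fun_prop),
    lintegral_one_add_norm_sq_rpow_neg (by linarith), show (ν + d) / 2 - d / 2 = ν / 2 by ring] at h
  have hC : C = ENNReal.ofReal
      (Real.Gamma ((ν + d) / 2) / (Real.Gamma (ν / 2) * Real.pi ^ ((d : ℝ) / 2))) := by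
    rw [ENNReal.eq_inv_of_mul_eq_one_left h, ← ENNReal.ofReal_inv_of_pos (by positivity), inv_div,
      mul_comm (Real.Gamma (ν / 2))]
  congr 1
  ext x
  rw [hC, ← ENNReal.ofReal_mul (by positivity), scaledStudentTPDF]

theorem map_mlEstimator_eq_scaledStudentT {N d : ℕ} (hdN : d ≤ N) :
    ((Measure.pi fun _ : Fin N => stdGaussian (EuclideanSpace ℝ (Fin d))).prod
        (stdGaussian (EuclideanSpace ℝ (Fin N)))).map
          (fun p => mlEstimator (rowMatrix p.1) p.2) =
      volume.withDensity fun x : EuclideanSpace ℝ (Fin d) =>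
        ENNReal.ofReal (scaledStudentTPDF (N + 1 - d) x) := by
  obtain ⟨C, hC⟩ := exists_map_mlEstimator_eq_withDensity hdN
  have hdN' : (d : ℝ) ≤ N := by exact_mod_cast hdN
  have hprob := Measure.isProbabilityMeasure_map
    (μ := (Measure.pi fun _ : Fin N => stdGaussian (EuclideanSpace ℝ (Fin d))).prod
        (stdGaussian (EuclideanSpace ℝ (Fin N))))
    (measurable_mlEstimator (N := N) (d := d)).aemeasurable
  have h1 := hprob.measure_univ
  rw [hC, show (N : ℝ) + 1 = (N + 1 - d) + d by ring] at h1
  rw [hC, ← withDensity_eq_scaledStudentT (by linarith) h1]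
  simp

/-! ### Affine images: from the scaled law to the Student law. -/

theorem map_const_add_withDensity {d : ℕ} (m : EuclideanSpace ℝ (Fin d))
    {F : EuclideanSpace ℝ (Fin d) → ENNReal} (hF : Measurable F) :
    (volume.withDensity fun x => F (m + x)).map (fun x => m + x) = volume.withDensity F := by
  have hmp := measurePreserving_add_left (volume : Measure (EuclideanSpace ℝ (Fin d))) m
  ext s hs
  rw [Measure.map_apply hmp.measurable hs, withDensity_apply _ (hmp.measurable hs),
    withDensity_apply _ hs, ← hmp.setLIntegral_comp_preimage hs hF]

theorem measurable_studentTPDF {d : ℕ} (ν : ℝ) (m : EuclideanSpace ℝ (Fin d))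
    (A : Matrix (Fin d) (Fin d) ℝ) : Measurable (studentTPDF ν m A) := by
  unfold studentTPDF
  simp only [dotProduct, Matrix.mulVec, PiLp.sub_apply]
  fun_prop

theorem map_scaledStudentT {d : ℕ} {ν : ℝ} (hν : 0 < ν) (m : EuclideanSpace ℝ (Fin d))
    {R A : Matrix (Fin d) (Fin d) ℝ} (hA : A.PosDef) (hR : R * Rᵀ = A) :
    (volume.withDensity fun x : EuclideanSpace ℝ (Fin d) =>
        ENNReal.ofReal (scaledStudentTPDF ν x)).map
      (fun x => m + WithLp.toLp 2 ((√ν • R) *ᵥ x.ofLp)) = studentT ν m A := by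
  have hdet := det_ne_zero_of_mul_transpose hR hA
  have hs : 0 < √ν := Real.sqrt_pos.2 hν
  have hf : LinearMap.det (Matrix.toEuclideanLin (√ν • R)) ≠ 0 := by
    rw [det_toEuclideanLin, Matrix.det_smul]
    positivity
  have hm : Measurable (Matrix.toEuclideanLin (√ν • R)) :=
    (Matrix.toEuclideanLin (√ν • R)).continuous_of_finiteDimensional.measurable
  have hF := (measurable_studentTPDF ν m A).ennreal_ofReal
  rw [studentT, ← map_const_add_withDensity m hF, ← map_linearMap_withDensity volume hf
    (F := fun x => ENNReal.ofReal (studentTPDF ν m A (m + x))) (hF.comp (measurable_const_add m)),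
    Measure.map_map (measurable_const_add m) hm]
  congr 2
  ext x
  rw [det_toEuclideanLin, ← ENNReal.ofReal_mul (abs_nonneg _)]
  congr 1
  have h := dotProduct_inv_mulVec_of_mul_transpose hR hA.det_pos.ne' x.ofLp
  have hsA : √A.det ≠ 0 := (Real.sqrt_pos.2 hA.det_pos).ne'
  have hq : √ν * (√ν * ‖x‖ ^ 2) / ν = ‖x‖ ^ 2 := by
    rw [← mul_assoc, Real.mul_self_sqrt hν.le, mul_div_cancel_left₀ _ hν.ne']
  rw [studentTPDF, add_sub_cancel_left,
    show (Matrix.toEuclideanLin (√ν • R) x).ofLp = √ν • (R *ᵥ x.ofLp) by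
      rw [← Matrix.smul_mulVec]; rfl,
    Matrix.mulVec_smul, smul_dotProduct, dotProduct_smul, h, ← norm_sq_eq_dotProduct, smul_eq_mul,
    smul_eq_mul, hq, Matrix.det_smul, abs_mul, abs_det_of_mul_transpose hR, scaledStudentTPDF,
    Fintype.card_fin, abs_of_pos (by positivity), Real.mul_rpow hν.le Real.pi_pos.le]
  have h3 : ν ^ ((d : ℝ) / 2) = √ν ^ d := by
    rw [Real.sqrt_eq_rpow, ← Real.rpow_natCast, ← Real.rpow_mul hν.le]
    congr 1; ring
  rw [h3]
  field_simp

/-! ### First and second moments. -/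

/-- Writing `‖x‖² = (1 + ‖x‖²) - 1` reduces the second moment to two integrals already known. The
smaller exponent `(ν + d)/2 - 1` exceeds `d/2` exactly when `ν > 2`. -/
theorem norm_sq_mul_scaledStudentTPDF {d : ℕ} (ν : ℝ) (x : EuclideanSpace ℝ (Fin d)) :
    ‖x‖ ^ 2 * scaledStudentTPDF ν x =
      Real.Gamma ((ν + d) / 2) / (Real.Gamma (ν / 2) * Real.pi ^ ((d : ℝ) / 2)) *
        ((1 + ‖x‖ ^ 2) ^ (-((ν + d) / 2 - 1)) - (1 + ‖x‖ ^ 2) ^ (-((ν + d) / 2))) := by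
  have hx : 0 < 1 + ‖x‖ ^ 2 := by positivity
  rw [scaledStudentTPDF, show -((ν + d) / 2 - 1) = -((ν + d) / 2) + 1 by ring,
    Real.rpow_add hx, Real.rpow_one]
  ring

theorem integrable_norm_sq_mul_scaledStudentTPDF {d : ℕ} {ν : ℝ} (hν : 2 < ν) :
    Integrable fun x : EuclideanSpace ℝ (Fin d) => ‖x‖ ^ 2 * scaledStudentTPDF ν x := by
  simp_rw [norm_sq_mul_scaledStudentTPDF]
  exact ((integrable_one_add_norm_sq_rpow_neg (by linarith)).sub
    (integrable_one_add_norm_sq_rpow_neg (by linarith))).const_mul _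

theorem integral_norm_sq_mul_scaledStudentTPDF {d : ℕ} {ν : ℝ} (hν : 2 < ν) :
    ∫ x : EuclideanSpace ℝ (Fin d), ‖x‖ ^ 2 * scaledStudentTPDF ν x = d / (ν - 2) := by
  simp_rw [norm_sq_mul_scaledStudentTPDF]
  have hd : (0 : ℝ) ≤ d := by positivity
  have h2 : 0 < ν / 2 - 1 := by linarith
  have h3 : 0 < (ν + d) / 2 - 1 := by linarith
  have e1 : Real.Gamma (ν / 2) = (ν / 2 - 1) * Real.Gamma (ν / 2 - 1) := by
    rw [← Real.Gamma_add_one h2.ne']; ring_nf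
  have e2 : Real.Gamma ((ν + d) / 2) = ((ν + d) / 2 - 1) * Real.Gamma ((ν + d) / 2 - 1) := by
    rw [← Real.Gamma_add_one h3.ne']; ring_nf
  have g2 := Real.Gamma_pos_of_pos h2
  have g3 := Real.Gamma_pos_of_pos h3
  rw [integral_const_mul, integral_sub (integrable_one_add_norm_sq_rpow_neg (by linarith))
    (integrable_one_add_norm_sq_rpow_neg (by linarith)),
    integral_one_add_norm_sq_rpow_neg (by linarith),
    integral_one_add_norm_sq_rpow_neg (by linarith),
    show (ν + d) / 2 - 1 - d / 2 = ν / 2 - 1 by ring, show (ν + d) / 2 - d / 2 = ν / 2 by ring,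
    e1, e2]
  generalize Real.Gamma (ν / 2 - 1) = G₁ at *
  generalize Real.Gamma ((ν + d) / 2 - 1) = G₂ at *
  have h4 : ν - 2 ≠ 0 := by linarith
  have h5 : ν + d - 2 ≠ 0 := by linarith
  field_simp
  ring

theorem scaledStudentTPDF_congr_norm {d : ℕ} {ν : ℝ} {x y : EuclideanSpace ℝ (Fin d)}
    (h : ‖x‖ = ‖y‖) : scaledStudentTPDF ν x = scaledStudentTPDF ν y := by
  rw [scaledStudentTPDF, scaledStudentTPDF, h]

theorem integral_comp_mul_scaledStudentTPDF {d : ℕ} (ν : ℝ)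
    (T : EuclideanSpace ℝ (Fin d) ≃ₗᵢ[ℝ] EuclideanSpace ℝ (Fin d))
    (F : EuclideanSpace ℝ (Fin d) → ℝ) :
    ∫ x, F (T x) * scaledStudentTPDF ν x = ∫ x, F x * scaledStudentTPDF ν x := by
  rw [← T.measurePreserving.integral_comp T.toHomeomorph.measurableEmbedding
    (fun x => F x * scaledStudentTPDF ν x)]
  simp_rw [scaledStudentTPDF_congr_norm (T.norm_map _)]

theorem integrable_coord_mul_coord_mul_scaledStudentTPDF {d : ℕ} {ν : ℝ} (hν : 2 < ν)
    (k l : Fin d) :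
    Integrable fun x : EuclideanSpace ℝ (Fin d) => x k * x l * scaledStudentTPDF ν x := by
  refine (integrable_norm_sq_mul_scaledStudentTPDF hν).mono' (by fun_prop)
    (ae_of_all _ fun x => ?_)
  rw [norm_mul, norm_mul, Real.norm_of_nonneg (scaledStudentTPDF_nonneg (by linarith) x), sq]
  exact mul_le_mul_of_nonneg_right (mul_le_mul (PiLp.norm_apply_le x k) (PiLp.norm_apply_le x l)
    (norm_nonneg _) (norm_nonneg _)) (scaledStudentTPDF_nonneg (by linarith) x)

/-- The density is radial. Swapping coordinates makes all diagonal moments equal, and they sum to `d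
/ (ν - 2)`; changing the sign of coordinate `k` alone makes a mixed moment equal to its own
negative. -/
theorem integral_coord_mul_coord_mul_scaledStudentTPDF {d : ℕ} {ν : ℝ} (hν : 2 < ν)
    (k l : Fin d) :
    ∫ x : EuclideanSpace ℝ (Fin d), x k * x l * scaledStudentTPDF ν x =
      if k = l then 1 / (ν - 2) else 0 := by
  split_ifs with hkl
  · subst hkl
    have h1 : ∀ j, ∫ x : EuclideanSpace ℝ (Fin d), x j * x j * scaledStudentTPDF ν x =
        ∫ x : EuclideanSpace ℝ (Fin d), x k * x k * scaledStudentTPDF ν x := by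
      intro j
      have := integral_comp_mul_scaledStudentTPDF ν
        (LinearIsometryEquiv.piLpCongrLeft 2 ℝ ℝ (Equiv.swap j k)) (fun x => x j * x j)
      rw [← this]
      simp [LinearIsometryEquiv.piLpCongrLeft_apply]
    have h2 := integral_norm_sq_mul_scaledStudentTPDF (d := d) hν
    simp_rw [EuclideanSpace.real_norm_sq_eq, Finset.sum_mul, sq] at h2
    rw [integral_finsetSum _ fun i _ =>
      integrable_coord_mul_coord_mul_scaledStudentTPDF hν i i] at h2
    simp_rw [h1] at h2
    rw [Finset.sum_const, Finset.card_univ, Fintype.card_fin, nsmul_eq_mul] at h2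
    have hd : (d : ℝ) ≠ 0 := by
      have := k.pos
      positivity
    apply mul_left_cancel₀ hd
    rw [h2]; ring
  · let T : EuclideanSpace ℝ (Fin d) ≃ₗᵢ[ℝ] EuclideanSpace ℝ (Fin d) :=
      LinearIsometryEquiv.piLpCongrRight 2 fun i =>
        if i = k then LinearIsometryEquiv.neg ℝ else LinearIsometryEquiv.refl ℝ ℝ
    have hT := integral_comp_mul_scaledStudentTPDF ν T (fun x => x k * x l)
    have h1 : ∀ x, T x k = -x k := fun x => by simp [T]
    have h2 : ∀ x, T x l = x l := fun x => by simp [T, Ne.symm hkl]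
    simp only [h1, h2, neg_mul, integral_neg] at hT
    linarith

theorem integral_coord_mul_scaledStudentTPDF {d : ℕ} (ν : ℝ) (k : Fin d) :
    ∫ x : EuclideanSpace ℝ (Fin d), x k * scaledStudentTPDF ν x = 0 := by
  have h := integral_comp_mul_scaledStudentTPDF ν (LinearIsometryEquiv.neg ℝ)
    (fun x : EuclideanSpace ℝ (Fin d) => x k)
  simp only [LinearIsometryEquiv.coe_neg, PiLp.neg_apply, neg_mul, integral_neg] at h
  linarith

section HasLaw

variable {Ω : Type*} [MeasurableSpace Ω] {P : Measure Ω} {d : ℕ} {ν : ℝ}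
  {Y : Ω → EuclideanSpace ℝ (Fin d)}

theorem integral_comp_of_hasLaw_scaledStudentT (hν : 0 < ν)
    (hY : HasLaw Y (volume.withDensity fun x => ENNReal.ofReal (scaledStudentTPDF ν x)) P)
    {F : EuclideanSpace ℝ (Fin d) → ℝ} (hF : Measurable F) :
    ∫ ω, F (Y ω) ∂P = ∫ x, F x * scaledStudentTPDF ν x := by
  have h := hY.integral_comp (f := F) hF.aestronglyMeasurable
  simp only [Function.comp_def] at h
  rw [h, integral_withDensity_eq_integral_toReal_smul (by fun_prop)
    (ae_of_all _ fun _ => ENNReal.ofReal_lt_top)]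
  congr 1
  ext x
  rw [ENNReal.toReal_ofReal (scaledStudentTPDF_nonneg hν x), smul_eq_mul, mul_comm]

theorem memLp_two_of_hasLaw_scaledStudentT (hν : 2 < ν)
    (hY : HasLaw Y (volume.withDensity fun x => ENNReal.ofReal (scaledStudentTPDF ν x)) P) :
    MemLp Y 2 P := by
  have h0 : 0 < ν := by linarith
  have h1 : MemLp id 2 (volume.withDensity
      fun x : EuclideanSpace ℝ (Fin d) => ENNReal.ofReal (scaledStudentTPDF ν x)) := by
    rw [memLp_two_iff_integrable_sq_norm (by fun_prop),
      integrable_withDensity_iff (by fun_prop) (ae_of_all _ fun _ => ENNReal.ofReal_lt_top)]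
    simp_rw [ENNReal.toReal_ofReal (scaledStudentTPDF_nonneg h0 _)]
    exact integrable_norm_sq_mul_scaledStudentTPDF hν
  rw [← hY.map_eq] at h1
  exact (memLp_map_measure_iff h1.1 hY.aemeasurable).1 h1

theorem covariance_of_hasLaw_scaledStudentT [IsProbabilityMeasure P] (hν : 2 < ν)
    (hY : HasLaw Y (volume.withDensity fun x => ENNReal.ofReal (scaledStudentTPDF ν x)) P)
    (k l : Fin d) :
    cov[fun ω => Y ω k, fun ω => Y ω l; P] = if k = l then 1 / (ν - 2) else 0 := by
  have h0 : 0 < ν := by linarith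
  have hL := memLp_two_of_hasLaw_scaledStudentT hν hY
  rw [covariance_eq_sub (hL.eval_piLp k) (hL.eval_piLp l)]
  have h1 := integral_comp_of_hasLaw_scaledStudentT h0 hY (F := fun x => x k * x l) (by fun_prop)
  have h2 := integral_comp_of_hasLaw_scaledStudentT h0 hY (F := fun x => x k) (by fun_prop)
  rw [integral_coord_mul_coord_mul_scaledStudentTPDF hν] at h1
  rw [integral_coord_mul_scaledStudentTPDF] at h2
  simp only [Pi.mul_apply]
  rw [h1, h2, zero_mul, sub_zero]

theorem covariance_affine_of_hasLaw_scaledStudentT [IsProbabilityMeasure P] (hν : 2 < ν)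
    (hY : HasLaw Y (volume.withDensity fun x => ENNReal.ofReal (scaledStudentTPDF ν x)) P)
    (m : EuclideanSpace ℝ (Fin d)) (B : Matrix (Fin d) (Fin d) ℝ) :
    Matrix.of (fun k l => cov[fun ω => (m + WithLp.toLp 2 (B *ᵥ (Y ω).ofLp)) k,
      fun ω => (m + WithLp.toLp 2 (B *ᵥ (Y ω).ofLp)) l; P]) = (1 / (ν - 2)) • (B * Bᵀ) := by
  have hL : ∀ k, MemLp (fun ω => Y ω k) 2 P :=
    fun k => (memLp_two_of_hasLaw_scaledStudentT hν hY).eval_piLp k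
  have hLs : ∀ k, MemLp (fun ω => ∑ j, B k j * Y ω j) 2 P :=
    fun k => memLp_finsetSum _ fun j _ => (hL j).const_mul _
  ext k l
  simp only [Matrix.of_apply, PiLp.add_apply, Matrix.mulVec, dotProduct]
  rw [covariance_const_add_left ((hLs k).integrable one_le_two),
    covariance_const_add_right ((hLs l).integrable one_le_two),
    covariance_fun_sum_fun_sum (fun j => (hL j).const_mul _) (fun j => (hL j).const_mul _)]
  simp only [covariance_const_mul_left, covariance_const_mul_right,
    covariance_of_hasLaw_scaledStudentT hν hY, Matrix.smul_apply, Matrix.mul_apply,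
    Matrix.transpose_apply, smul_eq_mul, Finset.mul_sum]
  refine Finset.sum_congr rfl fun i _ => ?_
  simp
  ring

theorem memLp_affine_of_hasLaw_scaledStudentT [IsProbabilityMeasure P] (hν : 2 < ν)
    (hY : HasLaw Y (volume.withDensity fun x => ENNReal.ofReal (scaledStudentTPDF ν x)) P)
    (m : EuclideanSpace ℝ (Fin d)) (B : Matrix (Fin d) (Fin d) ℝ) :
    MemLp (fun ω => m + WithLp.toLp 2 (B *ᵥ (Y ω).ofLp)) 2 P :=
  (memLp_const m).add <| (Matrix.toEuclideanCLM (𝕜 := ℝ) B).comp_memLp'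
    (memLp_two_of_hasLaw_scaledStudentT hν hY)

end HasLaw

/-! ### Optimality and equivariance of least squares. -/

theorem likelihood_eq {N d : ℕ} (s : ℝ≥0) (X : Matrix (Fin N) (Fin d) ℝ)
    (t : EuclideanSpace ℝ (Fin N)) (θ : EuclideanSpace ℝ (Fin d)) :
    likelihood s X t θ = (√(2 * Real.pi * s))⁻¹ ^ N *
      Real.exp (-((t.ofLp - X *ᵥ θ.ofLp) ⬝ᵥ (t.ofLp - X *ᵥ θ.ofLp)) / (2 * s)) := by
  simp only [likelihood, gaussianPDFReal, Finset.prod_mul_distrib, Finset.prod_const,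
    ← Real.exp_sum, Finset.card_univ, Fintype.card_fin]
  congr 2
  simp [dotProduct, sq, Finset.sum_div, neg_div]

theorem transpose_mulVec_residual {N d : ℕ} {X : Matrix (Fin N) (Fin d) ℝ}
    (hX : Function.Injective X.mulVec) (t : EuclideanSpace ℝ (Fin N)) :
    Xᵀ *ᵥ (t.ofLp - X *ᵥ (mlEstimator X t).ofLp) = 0 := by
  have hu : IsUnit (Xᵀ * X).det := (posDef_transpose_mul_self hX).det_pos.ne'.isUnit
  rw [Matrix.mulVec_sub, mlEstimator, Matrix.mulVec_mulVec, Matrix.mulVec_mulVec,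
    Matrix.mul_nonsing_inv _ hu, Matrix.one_mulVec, sub_self]

/-- By the normal equations the residual `r` is orthogonal to the range of `X`, so any other `θ`
raises the squared error by `u ⬝ᵥ u`, which is positive because `X` is injective. -/
theorem likelihood_lt_likelihood_mlEstimator {N d : ℕ} {X : Matrix (Fin N) (Fin d) ℝ}
    (hX : Function.Injective X.mulVec) (t : EuclideanSpace ℝ (Fin N)) {s : ℝ≥0} (hs : 0 < s)
    {θ : EuclideanSpace ℝ (Fin d)} (hθ : θ ≠ mlEstimator X t) :
    likelihood s X t θ < likelihood s X t (mlEstimator X t) := by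
  set θ' := mlEstimator X t with hθ'
  set r := t.ofLp - X *ᵥ θ'.ofLp with hr
  set u := X *ᵥ (θ'.ofLp - θ.ofLp) with hu
  have hru : r ⬝ᵥ u = 0 := by
    rw [hu, Matrix.dotProduct_mulVec, ← Matrix.mulVec_transpose, hr, hθ',
      transpose_mulVec_residual hX, zero_dotProduct]
  have hsum : t.ofLp - X *ᵥ θ.ofLp = r + u := by rw [hr, hu, Matrix.mulVec_sub]; abel
  have hu0 : u ≠ 0 := by
    intro h0
    apply hθ
    have := hX (h0.trans (Matrix.mulVec_zero X).symm)
    exact WithLp.ofLp_injective 2 (sub_eq_zero.1 this).symm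
  have hupos : 0 < u ⬝ᵥ u := lt_of_le_of_ne (dotProduct_self_star_nonneg u)
    (Ne.symm fun h => hu0 (dotProduct_self_eq_zero.1 h))
  have hs' : (0 : ℝ) < s := by exact_mod_cast hs
  rw [likelihood_eq, likelihood_eq, hsum, ← hr]
  refine mul_lt_mul_of_pos_left (Real.exp_lt_exp.2 ?_) (by positivity)
  refine div_lt_div_of_pos_right ?_ (by positivity)
  rw [add_dotProduct, dotProduct_add, dotProduct_add, dotProduct_comm u r, hru]
  linarith

theorem mlEstimator_response {N d : ℕ} {X : Matrix (Fin N) (Fin d) ℝ}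
    (hX : Function.Injective X.mulVec) (θ : EuclideanSpace ℝ (Fin d))
    (ε : EuclideanSpace ℝ (Fin N)) :
    mlEstimator X (response X θ ε) = θ + mlEstimator X ε := by
  have hu : IsUnit (Xᵀ * X).det := (posDef_transpose_mul_self hX).det_pos.ne'.isUnit
  apply WithLp.ofLp_injective 2
  simp only [mlEstimator, response, WithLp.ofLp_add]
  rw [Matrix.mulVec_add, Matrix.mulVec_add, Matrix.mulVec_mulVec, Matrix.mulVec_mulVec,
    Matrix.mul_assoc, Matrix.nonsing_inv_mul _ hu, Matrix.one_mulVec]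

/-- Reparametrisation by `Q`: this moves the covariance of the inputs out of the design, leaving a
standard Gaussian matrix. -/
theorem mlEstimator_mul {N d : ℕ} (M : Matrix (Fin N) (Fin d) ℝ) {Q : Matrix (Fin d) (Fin d) ℝ}
    (hQ : Q.det ≠ 0) (t : EuclideanSpace ℝ (Fin N)) :
    mlEstimator (M * Q) t = WithLp.toLp 2 (Q⁻¹ *ᵥ (mlEstimator M t).ofLp) := by
  have hQt : IsUnit Qᵀ.det := by rw [Matrix.det_transpose]; exact hQ.isUnit
  simp only [mlEstimator]
  rw [Matrix.transpose_mul, Matrix.mul_assoc, ← Matrix.mul_assoc Mᵀ, Matrix.mul_inv_rev,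
    Matrix.mul_inv_rev, Matrix.mulVec_mulVec, Matrix.mulVec_mulVec, Matrix.mulVec_mulVec]
  congr 2
  rw [Matrix.mul_assoc _ Qᵀ⁻¹, ← Matrix.mul_assoc Qᵀ⁻¹, Matrix.nonsing_inv_mul _ hQt,
    Matrix.one_mul, Matrix.mul_assoc]

theorem mlEstimator_smul {N d : ℕ} (M : Matrix (Fin N) (Fin d) ℝ) (c : ℝ)
    (t : EuclideanSpace ℝ (Fin N)) : mlEstimator M (c • t) = c • mlEstimator M t := by
  simp [mlEstimator, Matrix.mulVec_smul]

theorem injective_mul_mulVec {N d : ℕ} {M : Matrix (Fin N) (Fin d) ℝ}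
    (hM : Function.Injective M.mulVec) {Q : Matrix (Fin d) (Fin d) ℝ} (hQ : Q.det ≠ 0) :
    Function.Injective (M * Q).mulVec := by
  have hQ' : Function.Injective Q.mulVec :=
    Matrix.mulVec_injective_iff_isUnit.2 ((Matrix.isUnit_iff_isUnit_det Q).2 hQ.isUnit)
  intro v w h
  simp only [← Matrix.mulVec_mulVec] at h
  exact hQ' (hM h)

theorem design_eq_rowMatrix_mul {N d : ℕ} (R : Matrix (Fin d) (Fin d) ℝ)
    (z g : Fin N → EuclideanSpace ℝ (Fin d))
    (hz : ∀ i, z i = WithLp.toLp 2 (R *ᵥ (g i).ofLp)) :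
    design z = rowMatrix g * ((√(d : ℝ))⁻¹ • Rᵀ) := by
  ext i k
  simp only [design, rowMatrix, hz, Matrix.of_apply, Matrix.mul_apply, Matrix.smul_apply,
    Matrix.transpose_apply, smul_eq_mul, Matrix.mulVec, dotProduct, Finset.sum_div]
  exact Finset.sum_congr rfl fun j _ => by ring

theorem hasLaw_inv_mulVec_multivariateGaussian {n : Type*} [Fintype n] [DecidableEq n]
    {R S : Matrix n n ℝ} (hRS : R * Rᵀ = S) (hR : R.det ≠ 0) :
    HasLaw (fun x => WithLp.toLp 2 (R⁻¹ *ᵥ x.ofLp)) (stdGaussian (EuclideanSpace ℝ n))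
      (multivariateGaussian 0 S) := by
  have hm : ∀ B : Matrix n n ℝ,
      Measurable fun e : EuclideanSpace ℝ n => WithLp.toLp 2 (B *ᵥ e.ofLp) :=
    fun B => (Matrix.toEuclideanLin B).continuous_of_finiteDimensional.measurable
  refine ⟨(hm _).aemeasurable, ?_⟩
  rw [← hRS, ← map_mulVec_stdGaussian, Measure.map_map (hm _) (hm _)]
  convert Measure.map_id
  ext x
  simp [Matrix.mulVec_mulVec, Matrix.nonsing_inv_mul _ hR.isUnit]

theorem studentTPDF_smul_inv {d : ℕ} {ν a : ℝ} (hν : 0 < ν) (ha : 0 < a)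
    (m : EuclideanSpace ℝ (Fin d)) {S : Matrix (Fin d) (Fin d) ℝ} (hS : S.PosDef)
    (x : EuclideanSpace ℝ (Fin d)) :
    studentTPDF ν m (a • S⁻¹) x =
      (Real.pi * ν) ^ (-((d : ℝ) / 2)) *
        (Real.Gamma ((ν + d) / 2) / Real.Gamma (ν / 2)) *
        (a⁻¹ • S).det ^ ((1 : ℝ) / 2) *
        (1 + (x - m).ofLp ⬝ᵥ (((a * ν)⁻¹ • S) *ᵥ (x - m).ofLp)) ^ (-((ν + d) / 2)) := by
  have hu : IsUnit S.det := hS.det_pos.ne'.isUnit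
  have hinv : (a • S⁻¹)⁻¹ = a⁻¹ • S := by
    apply Matrix.inv_eq_right_inv
    rw [Matrix.smul_mul, Matrix.mul_smul, smul_smul, mul_inv_cancel₀ ha.ne', one_smul,
      Matrix.nonsing_inv_mul _ hu]
  have hdet : (a⁻¹ • S).det ^ ((1 : ℝ) / 2) = (√(a • S⁻¹).det)⁻¹ := by
    rw [← hinv, Matrix.det_nonsing_inv, Ring.inverse_eq_inv', ← Real.sqrt_eq_rpow, Real.sqrt_inv]
  rw [studentTPDF, hdet, hinv, Real.rpow_neg (mul_nonneg Real.pi_pos.le hν.le), mul_comm Real.pi ν,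
    Matrix.smul_mulVec, Matrix.smul_mulVec, dotProduct_smul, dotProduct_smul, smul_eq_mul,
    smul_eq_mul, mul_inv, mul_right_comm a⁻¹, ← div_eq_mul_inv (a⁻¹ * _)]
  congr 1
  rw [div_eq_mul_inv, div_eq_mul_inv, mul_inv, mul_inv]
  ring

theorem studentTPDF_lt_studentTPDF_location {d : ℕ} {ν : ℝ} (hν : 0 < ν)
    {m x : EuclideanSpace ℝ (Fin d)} {A : Matrix (Fin d) (Fin d) ℝ} (hA : A.PosDef) (hx : x ≠ m) :
    studentTPDF ν m A x < studentTPDF ν m A m := by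
  have h1 := Real.Gamma_pos_of_pos (show 0 < (ν + d) / 2 by positivity)
  have h2 := Real.Gamma_pos_of_pos (show 0 < ν / 2 by positivity)
  have h3 := Real.sqrt_pos.2 hA.det_pos
  have hq : 0 < (x - m).ofLp ⬝ᵥ (A⁻¹ *ᵥ (x - m).ofLp) := by
    refine hA.inv.dotProduct_mulVec_pos fun h => hx ?_
    exact sub_eq_zero.1 (WithLp.ofLp_injective 2 h)
  have hp := Real.pi_pos
  rw [studentTPDF, studentTPDF]
  refine mul_lt_mul_of_pos_left ?_ (by positivity)
  have : 0 < (ν + d) / 2 := by positivity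
  simp only [sub_self, WithLp.ofLp_zero, zero_dotProduct, zero_div, add_zero, Real.one_rpow]
  refine Real.rpow_lt_one_of_one_lt_of_neg ?_ (by linarith)
  have : 0 < ((x - m).ofLp ⬝ᵥ (A⁻¹ *ᵥ (x - m).ofLp)) / ν := by positivity
  linarith

theorem smul_inv_mul_transpose_smul_inv {d : ℕ} (hd : 0 < (d : ℝ))
    {R S : Matrix (Fin d) (Fin d) ℝ} (hS : S.PosDef) (hR : R * Rᵀ = S) {σ : ℝ} :
    (σ • ((√(d : ℝ))⁻¹ • Rᵀ)⁻¹) * (σ • ((√(d : ℝ))⁻¹ • Rᵀ)⁻¹)ᵀ = (d * σ ^ 2) • S⁻¹ := by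
  have hdet := det_ne_zero_of_mul_transpose hR hS
  have hRt : IsUnit Rᵀ.det := by rw [Matrix.det_transpose]; exact hdet.isUnit
  have hs : √(d : ℝ) ≠ 0 := (Real.sqrt_pos.2 hd).ne'
  have hinv : ((√(d : ℝ))⁻¹ • Rᵀ)⁻¹ = √(d : ℝ) • Rᵀ⁻¹ := by
    apply Matrix.inv_eq_right_inv
    rw [Matrix.smul_mul, Matrix.mul_smul, smul_smul, inv_mul_cancel₀ hs, one_smul,
      Matrix.mul_nonsing_inv _ hRt]
  rw [hinv, smul_smul, Matrix.transpose_smul, Matrix.smul_mul, Matrix.mul_smul, smul_smul, ← hR,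
    Matrix.mul_inv_rev, Matrix.transpose_nonsing_inv, Matrix.transpose_transpose]
  congr 1
  rw [mul_mul_mul_comm, Real.mul_self_sqrt hd.le]
  ring

theorem covariance_congr_ae {Ω : Type*} [MeasurableSpace Ω] {P : Measure Ω} {X X' Y Y' : Ω → ℝ}
    (hX : X =ᵐ[P] X') (hY : Y =ᵐ[P] Y') : cov[X, Y; P] = cov[X', Y'; P] := by
  simp only [covariance, integral_congr_ae hX, integral_congr_ae hY]
  refine integral_congr_ae ?_
  filter_upwards [hX, hY] with ω h1 h2
  rw [h1, h2]

/-! ### Reduction to standard data and the main theorem. -/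

/-- `Y` is the estimator computed from the whitened inputs `g` and noise `e`, which remain
independent. The affine identity holds only almost surely because it needs full column rank. -/
theorem exists_standardized_estimator {Ω : Type*} [MeasurableSpace Ω] (P : Measure Ω)
    [IsProbabilityMeasure P] {N d : ℕ} (hd : 1 ≤ d) (hdN : d ≤ N)
    {R S : Matrix (Fin d) (Fin d) ℝ} (hS : S.PosDef) (hR : R * Rᵀ = S)
    (θ₀ : EuclideanSpace ℝ (Fin d)) {σ₀ : ℝ} (hσ₀ : 0 < σ₀)
    {z : Fin N → Ω → EuclideanSpace ℝ (Fin d)} {ε : Ω → EuclideanSpace ℝ (Fin N)}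
    (hz : ∀ i, HasLaw (z i) (multivariateGaussian 0 S) P)
    (hz_indep : iIndepFun z P)
    (hε : HasLaw ε (multivariateGaussian 0 (σ₀ ^ 2 • (1 : Matrix (Fin N) (Fin N) ℝ))) P)
    (hzε : IndepFun (fun ω i => z i ω) ε P) :
    ∃ Y : Ω → EuclideanSpace ℝ (Fin d),
      HasLaw Y (volume.withDensity fun x => ENNReal.ofReal (scaledStudentTPDF (N + 1 - d) x)) P ∧
      ∀ᵐ ω ∂P, Function.Injective (design (z · ω)).mulVec ∧
        mlEstimator (design (z · ω)) (response (design (z · ω)) θ₀ (ε ω)) =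
          θ₀ + WithLp.toLp 2 ((σ₀ • ((√(d : ℝ))⁻¹ • Rᵀ)⁻¹) *ᵥ (Y ω).ofLp) := by
  have hdet := det_ne_zero_of_mul_transpose hR hS
  have hd0 : (0 : ℝ) < d := by exact_mod_cast hd
  have hQ : ((√(d : ℝ))⁻¹ • Rᵀ).det ≠ 0 := by
    rw [Matrix.det_smul, Matrix.det_transpose]
    have := Real.sqrt_pos.2 hd0
    positivity
  have hm : ∀ {n : ℕ} (B : Matrix (Fin n) (Fin n) ℝ),
      Measurable fun e : EuclideanSpace ℝ (Fin n) => WithLp.toLp 2 (B *ᵥ e.ofLp) :=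
    fun B => (Matrix.toEuclideanLin B).continuous_of_finiteDimensional.measurable
  let R' : Matrix (Fin N) (Fin N) ℝ := σ₀ • 1
  have hR' : R' * R'ᵀ = σ₀ ^ 2 • (1 : Matrix (Fin N) (Fin N) ℝ) := by
    simp [R', smul_smul, sq]
  have hdet' : R'.det ≠ 0 := by simp [R', hσ₀.ne']
  let g : Fin N → Ω → EuclideanSpace ℝ (Fin d) :=
    fun i ω => WithLp.toLp 2 (R⁻¹ *ᵥ (z i ω).ofLp)
  let e : Ω → EuclideanSpace ℝ (Fin N) := fun ω => WithLp.toLp 2 (R'⁻¹ *ᵥ (ε ω).ofLp)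
  have hg : ∀ i, HasLaw (g i) (stdGaussian _) P := fun i =>
    (hasLaw_inv_mulVec_multivariateGaussian hR hdet).fun_comp (hz i)
  have he : HasLaw e (stdGaussian _) P :=
    (hasLaw_inv_mulVec_multivariateGaussian hR' hdet').fun_comp hε
  have hg_indep : iIndepFun g P := hz_indep.comp _ fun _ => hm R⁻¹
  have hg_law : HasLaw (fun ω i => g i ω) (Measure.pi fun _ => stdGaussian _) P :=
    hg_indep.hasLaw_pi hg
  have hge : IndepFun (fun ω i => g i ω) e P :=
    hzε.comp (φ := fun v i => WithLp.toLp 2 (R⁻¹ *ᵥ (v i).ofLp))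
      (measurable_pi_lambda _ fun i => (hm R⁻¹).comp (measurable_pi_apply i)) (hm R'⁻¹)
  have hjoint := hge.hasLaw_prod hg_law he
  have hinj : ∀ᵐ ω ∂P, Function.Injective (rowMatrix fun i => g i ω).mulVec := by
    have h := ae_injective_rowMatrix_gaussian hdN
    rw [← hg_law.map_eq] at h
    exact ae_of_ae_map hg_law.aemeasurable h
  have hml := HasLaw.mk measurable_mlEstimator.aemeasurable (map_mlEstimator_eq_scaledStudentT hdN)
  refine ⟨_, hml.comp hjoint, ?_⟩
  filter_upwards [hinj] with ω hω
  have hdes := design_eq_rowMatrix_mul R (z · ω) (fun i => g i ω) fun i => by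
    simp [g, Matrix.mulVec_mulVec, Matrix.mul_nonsing_inv _ hdet.isUnit]
  have hεe : ε ω = σ₀ • e ω := by
    have : (σ₀ • e ω).ofLp = R' *ᵥ (R'⁻¹ *ᵥ (ε ω).ofLp) := by
      simp only [R', e, Matrix.smul_mulVec, Matrix.one_mulVec, WithLp.ofLp_smul]
    rw [Matrix.mulVec_mulVec, Matrix.mul_nonsing_inv _ hdet'.isUnit, Matrix.one_mulVec] at this
    exact (WithLp.ofLp_injective 2 this).symm
  rw [hdes]
  refine ⟨injective_mul_mulVec hω hQ, ?_⟩
  rw [mlEstimator_response (injective_mul_mulVec hω hQ), mlEstimator_mul _ hQ, hεe,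
    mlEstimator_smul, Function.comp_apply, WithLp.ofLp_smul, Matrix.mulVec_smul, Matrix.smul_mulVec]

end GaussianRegression

theorem mainTheorem4 {Ω : Type*} [MeasurableSpace Ω] (P : Measure Ω) [IsProbabilityMeasure P]
    (N d : ℕ) (hd : 1 ≤ d) (hdN : d ≤ N)
    (S : Matrix (Fin d) (Fin d) ℝ) (hS : S.PosDef)
    (θ₀ : EuclideanSpace ℝ (Fin d)) (σ₀ : ℝ) (hσ₀ : 0 < σ₀)
    (ζ : ℝ) (hζ : ζ = (d : ℝ) / N)
    (z : Fin N → Ω → EuclideanSpace ℝ (Fin d)) (ε : Ω → EuclideanSpace ℝ (Fin N))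
    (hz : ∀ i, HasLaw (z i) (multivariateGaussian 0 S) P)
    (hz_indep : iIndepFun z P)
    (hε : HasLaw ε (multivariateGaussian 0 (σ₀ ^ 2 • (1 : Matrix (Fin N) (Fin N) ℝ))) P)
    (hzε : IndepFun (fun ω i => z i ω) ε P)
    (X : Ω → Matrix (Fin N) (Fin d) ℝ) (hX : X = fun ω => GaussianRegression.design (z · ω))
    (t : Ω → EuclideanSpace ℝ (Fin N))
    (ht : t = fun ω => GaussianRegression.response (X ω) θ₀ (ε ω))
    (θML : Ω → EuclideanSpace ℝ (Fin d))
    (hθML : θML = fun ω => GaussianRegression.mlEstimator (X ω) (t ω))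
    (A : Matrix (Fin d) (Fin d) ℝ) (hA : A = (ζ * σ₀ ^ 2 / (1 - ζ + 1 / N)) • S⁻¹) :
    -- almost surely, the estimator is the unique maximizer of the likelihood
    (∀ᵐ ω ∂P, ∀ s : ℝ≥0, 0 < s → ∀ θ, θ ≠ θML ω →
      GaussianRegression.likelihood s (X ω) (t ω) θ <
        GaussianRegression.likelihood s (X ω) (t ω) (θML ω)) ∧
    -- its law is the Student t-distribution
    HasLaw θML (GaussianRegression.studentT (N + 1 - d) θ₀ A) P ∧
    -- the density in explicit form
    (∀ x, GaussianRegression.studentTPDF (N + 1 - d) θ₀ A x =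
      (Real.pi * (N + 1 - d)) ^ (-((d : ℝ) / 2)) *
        (Real.Gamma (((N : ℝ) + 1) / 2) / Real.Gamma (((N : ℝ) + 1 - d) / 2)) *
        (((1 - ζ + 1 / N) / (ζ * σ₀ ^ 2)) • S).det ^ ((1 : ℝ) / 2) *
        (1 + (x - θ₀).ofLp ⬝ᵥ
          ((((1 - ζ + 1 / N) / (ζ * σ₀ ^ 2 * (N + 1 - d))) • S) *ᵥ (x - θ₀).ofLp)) ^
            (-(((N : ℝ) + 1) / 2))) ∧
    -- `θ₀` is its unique mode
    (∀ x, x ≠ θ₀ → GaussianRegression.studentTPDF (N + 1 - d) θ₀ A x <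
      GaussianRegression.studentTPDF (N + 1 - d) θ₀ A θ₀) ∧
    -- its covariance matrix, which is finite for more than two degrees of freedom
    (d + 1 < N → MemLp θML 2 P ∧
      Matrix.of (fun k l => cov[fun ω => θML ω k, fun ω => θML ω l; P]) =
        (ζ * σ₀ ^ 2 / (1 - ζ - 1 / N)) • S⁻¹) := by
  have hNd : (d : ℝ) ≤ N := by exact_mod_cast hdN
  have hd0 : (0 : ℝ) < d := by exact_mod_cast hd
  have hN0 : (0 : ℝ) < N := by linarith
  have hν : (0 : ℝ) < N + 1 - d := by linarith
  -- With `ν = N + 1 - d` the denominator is `ν / N`, so the shape matrix is `(d σ₀² / ν) • S⁻¹`.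
  have hden : 1 - ζ + 1 / N = (N + 1 - d) / N := by rw [hζ]; field_simp; ring
  have hcoef : ζ * σ₀ ^ 2 / (1 - ζ + 1 / N) = d * σ₀ ^ 2 / (N + 1 - d) := by
    rw [hden, hζ]; field_simp
  have hcoef0 : 0 < ζ * σ₀ ^ 2 / (1 - ζ + 1 / N) := by rw [hcoef]; positivity
  have hApd : A.PosDef := by rw [hA]; exact hS.inv.smul hcoef0
  obtain ⟨R, hR⟩ : ∃ R : Matrix (Fin d) (Fin d) ℝ, R * Rᵀ = S :=
    ⟨_, GaussianRegression.sqrt_mul_transpose_sqrt hS.posSemidef⟩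
  set Q : Matrix (Fin d) (Fin d) ℝ := (√(d : ℝ))⁻¹ • Rᵀ with hQ
  have hB : (σ₀ • Q⁻¹) * (σ₀ • Q⁻¹)ᵀ = (d * σ₀ ^ 2) • S⁻¹ :=
    GaussianRegression.smul_inv_mul_transpose_smul_inv hd0 hS hR
  have hjoint := GaussianRegression.exists_standardized_estimator P hd hdN hS hR θ₀ hσ₀ hz
    hz_indep hε hzε
  rw [← hQ] at hjoint
  obtain ⟨Y, hY, hae⟩ := hjoint
  have hθ : θML =ᵐ[P] fun ω => θ₀ + WithLp.toLp 2 ((σ₀ • Q⁻¹) *ᵥ (Y ω).ofLp) := by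
    filter_upwards [hae] with ω hω
    rw [hθML, ht, hX]
    exact hω.2
  refine ⟨?_, ?_, ?_, ?_, ?_⟩
  · filter_upwards [hae] with ω hω s hs θ hne
    rw [hθML] at hne ⊢
    exact GaussianRegression.likelihood_lt_likelihood_mlEstimator (by rw [hX]; exact hω.1) _ hs hne
  · refine HasLaw.congr ?_ hθ
    -- The factor `(√ν)⁻¹` cancels the `√ν` built into `map_scaledStudentT`.
    have hRA : ((√((N : ℝ) + 1 - d))⁻¹ • σ₀ • Q⁻¹) * ((√((N : ℝ) + 1 - d))⁻¹ • σ₀ • Q⁻¹)ᵀ = A := by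
      rw [Matrix.transpose_smul, Matrix.smul_mul, Matrix.mul_smul, hB, hA, hcoef, smul_smul,
        smul_smul, ← mul_inv, Real.mul_self_sqrt hν.le]
      congr 1
      field_simp
    have hmap := GaussianRegression.map_scaledStudentT hν θ₀ hApd hRA
    rw [smul_smul, mul_inv_cancel₀ (Real.sqrt_pos.2 hν).ne', one_smul] at hmap
    have hm : Measurable fun x : EuclideanSpace ℝ (Fin d) =>
        θ₀ + WithLp.toLp 2 ((σ₀ • Q⁻¹) *ᵥ x.ofLp) :=
      (Matrix.toEuclideanLin (σ₀ • Q⁻¹)).continuous_of_finiteDimensional.measurable.const_add θ₀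
    exact (HasLaw.mk hm.aemeasurable hmap).fun_comp hY
  · intro x
    rw [hA, GaussianRegression.studentTPDF_smul_inv hν hcoef0 θ₀ hS, sub_add_cancel, inv_div]
    congr 6
    rw [hcoef, hden, hζ]
    field_simp
  · exact fun x hx => GaussianRegression.studentTPDF_lt_studentTPDF_location hν hApd hx
  · intro hdN1
    -- `d + 1 < N` says exactly `ν > 2`.
    have hν2 : (2 : ℝ) < N + 1 - d := by
      have : (d : ℝ) + 1 < N := by exact_mod_cast hdN1
      linarith
    refine ⟨(memLp_congr_ae hθ).2
      (GaussianRegression.memLp_affine_of_hasLaw_scaledStudentT hν2 hY _ _), ?_⟩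
    have hcov : ∀ k l, cov[fun ω => θML ω k, fun ω => θML ω l; P] =
        cov[fun ω => (θ₀ + WithLp.toLp 2 ((σ₀ • Q⁻¹) *ᵥ (Y ω).ofLp)) k,
          fun ω => (θ₀ + WithLp.toLp 2 ((σ₀ • Q⁻¹) *ᵥ (Y ω).ofLp)) l; P] := by
      intro k l
      refine GaussianRegression.covariance_congr_ae ?_ ?_
      · filter_upwards [hθ] with ω hω using by rw [hω]
      · filter_upwards [hθ] with ω hω using by rw [hω]
    simp_rw [hcov]
    rw [GaussianRegression.covariance_affine_of_hasLaw_scaledStudentT hν2 hY, hB, smul_smul]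
    congr 1
    have h1 : (N : ℝ) + 1 - d - 2 ≠ 0 := by linarith
    -- The sign of `1 / N` changes from the shape matrix to the covariance because `ν` is replaced
    -- by `ν - 2`.
    have h2 : 1 - ζ - 1 / N = (N + 1 - d - 2) / N := by rw [hζ]; field_simp; ring
    rw [h2, hζ]
    field_simp
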